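/- Let $K$ be a field of characteristic $0$ (for instance $K=\mathbb{Q}$). **Quasisymmetric functions.** For a composition $\alpha=(a_1,\dots,a_k)$ (a finite, possibly empty, sequence of positive integers) let $M_\alpha=\sum_{i_1<\cdots<i_k}x_{i_1}^{a_1}\cdots x_{i_k}^{a_k}$, let $\mathcal{Q}_n$ be the $K$-span of the $M_\alpha$ with $\alpha\in\mathrm{Comp}(n)$, the set of compositions of $n$, and let $\mathcal{Q}=\bigoplus_n\mathcal{Q}_n$ be the graded Hopf algebra of quasisymmetric functions, with the product of power series and the coproduct $\Delta(M_\alpha)=\sum_{\alpha=\beta\cdot\gamma}M_\beta\otimes M_\gamma$ (concatenation). Let $\Phi$ be an endomorphism of the graded Hopf algebra $\mathcal{Q}$ (so $\Phi(\mathcal{Q}_n)\subseteq\mathcal{Q}_n$), and $\Phi_n=\Phi|_{\mathcal{Q}_n}$. **Descent algebra.** For $\alpha=(a_1,\dots,a_k)\in\mathrm{Comp}(n)$ put $S_\alpha=\{a_1,a_1+a_2,\dots,a_1+\cdots+a_{k-1}\}$, and let $X_\alpha\in K[\mathfrak{S}_n]$ be the sum of all permutations $\sigma$ whose descent set $\{i\in[n-1]:\sigma_i>\sigma_{i+1}\}$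 is contained in $S_\alpha$. The $X_\alpha$ form a basis of the descent algebra $\mathcal{D}_n\subseteq K[\mathfrak{S}_n]$; write $\cdot$ for the product of the group algebra. Put $X_n=X_{(n)}$ for $n\ge1$ and $X_0=X_{()}$, and similarly $M_n=M_{(n)}$, $M_0=M_{()}=1$; for $m=0$ the composition $(m)$ is read as $()$. Let $\star$ be the bilinear product on $\bigoplus_n\mathcal{D}_n$ with $X_\alpha\star X_\beta=X_{\alpha\cdot\beta}$, and pair $\prod_n\mathcal{D}_n$ with $\mathcal{Q}$ by $\langle X_\alpha,M_\beta\rangle=\delta_{\alpha,\beta}$. With $X=\sum_nX_n$, let $X^\Phi=\sum_n(X^\Phi)_n$, $(X^\Phi)_n\in\mathcal{D}_n$, be the series with $\langle X^\Phi,G\rangle=\langle X,\Phi(G)\rangle$ for all $G\in\mathcal{Q}$. Put $\lambda_m=\langle X^\Phi,M_m\rangle$ and $\lambda_\alpha=\lambda_{a_1}\cdots\lambda_{a_k}$ for $\alpha=(a_1,\dots,a_k)$. **The elements $Z_\alpha$.** Write $\alpha<\beta$ for $\alpha,\beta\in\mathrm{Comp}(m)$ if $S_\alpha\subsetneq S_\beta$.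 If $\lambda_m\ne0$ and $\lambda_m\neq\lambda_\beta$ for all $\beta\in\mathrm{Comp}(m)\setminus\{(m)\}$, define $Z_m\in\mathcal{D}_m$ recursively by $\langle Z_m,M_m\rangle=1$ and $$\langle Z_m,M_\beta\rangle=\frac1{\lambda_m-\lambda_\beta}\sum_{\alpha<\beta}\langle Z_m,M_\alpha\rangle\,\langle X^\Phi\cdot X_\alpha,M_\beta\rangle\qquad(\beta\in\mathrm{Comp}(m)\setminus\{(m)\}),$$ and put $Z_\alpha=Z_{a_1}\star\cdots\star Z_{a_k}$ for $\alpha=(a_1,\dots,a_k)$ whenever all $Z_{a_i}$ are defined (so $Z_{()}=X_{()}$). **Theorem.** Let $n\ge0$. Suppose that for every $m\le n$ with $\lambda_m\neq0$ one has $\lambda_m\ne\lambda_\beta$ for all $\beta\in\mathrm{Comp}(m)\setminus\{(m)\}$, and that $\operatorname{rank}(\Phi_n)=\#\{\alpha\in\mathrm{Comp}(n):\lambda_\alpha\ne0\}$. Then: 1. $\Phi_n$ is diagonalizable over $K$. 2. Left multiplication $W\mapsto(X^\Phi)_n\cdot W$ maps $\mathcal{D}_n$ to itself, and is a diagonalizable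 operator on $\mathcal{D}_n$. 3. For every $\alpha\in\mathrm{Comp}(n)$ with $\lambda_\alpha\neq0$ one has $(X^\Phi)_n\cdot Z_\alpha=\lambda_\alpha Z_\alpha$; these $Z_\alpha$ are linearly independent; and for every $\mu\in K\setminus\{0\}$ the $Z_\alpha$ with $\lambda_\alpha=\mu$ span the eigenspace of the operator in 2 for the value $\mu$. -/

import Mathlib

open scoped TensorProduct
noncomputable section
namespace QSymWalk

/-- The nonzero exponents of the monomial `x^d`, listed in the order of the variables. -/
def exponents (d : ℕ →₀ ℕ) : List ℕ := (d.support.sort (· ≤ ·)).map d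

theorem exponents_pos (d : ℕ →₀ ℕ) {a : ℕ} (h : a ∈ exponents d) : 0 < a := by
  simp only [exponents, List.mem_map, Finset.mem_sort, Finsupp.mem_support_iff] at h
  obtain ⟨i, hi, rfl⟩ := h
  exact Nat.pos_of_ne_zero hi

theorem exponents_sum (d : ℕ →₀ ℕ) : (exponents d).sum = d.degree := by
  rw [exponents, Finsupp.degree_apply]
  rw [← Finset.sum_map_toList]
  exact ((Finset.sort_perm_toList (s := d.support) (· ≤ ·)).map d).sum_eq

theorem exponents_mapDomain (e : ℕ → ℕ) (p : ℕ →₀ ℕ) (he : StrictMonoOn e p.support) :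
    exponents (p.mapDomain e) = exponents p := by
  classical
  have hs : (p.mapDomain e).support.sort (· ≤ ·) = (p.support.sort (· ≤ ·)).map e := by
    rw [Finsupp.mapDomain_support_of_injOn p he.injOn]
    refine List.Perm.eq_of_pairwise' (r := (· ≤ ·)) ?_ (Finset.pairwise_sort _ _) ?_ |>.symm
    · rw [List.pairwise_map]
      refine List.Pairwise.imp_of_mem ?_ (Finset.pairwise_sort p.support (· ≤ ·))
      intro a b ha hb hab
      exact he.monotoneOn (by simpa using ha) (by simpa using hb) hab
    · refine (List.perm_of_nodup_nodup_toFinset_eq ?_ (Finset.sort_nodup _ _) ?_)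
      · refine List.Nodup.map_on ?_ (Finset.sort_nodup _ _)
        intro x hx y hy h
        exact he.injOn (by simpa using hx) (by simpa using hy) h
      · ext x
        simp
  rw [exponents, exponents, hs, List.map_map]
  refine List.map_congr_left fun i hi => ?_
  exact Finsupp.mapDomain_apply' (p.support : Set ℕ) p subset_rfl he.injOn (by simpa using hi)

theorem exists_transport {d d' : ℕ →₀ ℕ} (h : exponents d = exponents d') :
    ∃ e e' : ℕ → ℕ, StrictMonoOn e d.support ∧ StrictMonoOn e' d'.support ∧
      d.mapDomain e = d' ∧ d'.mapDomain e' = d ∧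
      (∀ i ∈ d.support, e' (e i) = i) ∧ (∀ i ∈ d'.support, e (e' i) = i) := by
  classical
  have hc : d.support.card = d'.support.card := by
    simpa [exponents] using congrArg List.length h
  let o : d.support ≃o d'.support :=
    (d.support.orderIsoOfFin rfl).symm.trans (d'.support.orderIsoOfFin hc.symm)
  have ho : ∀ i : d.support, d' (o i) = d i := by
    intro i
    obtain ⟨k, rfl⟩ := (d.support.orderIsoOfFin rfl).surjective i
    have h1 : o (d.support.orderIsoOfFin rfl k) = d'.support.orderIsoOfFin hc.symm k := by
      simp [o]
    rw [h1, Finset.coe_orderIsoOfFin_apply, Finset.coe_orderIsoOfFin_apply,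
      Finset.orderEmbOfFin_apply, Finset.orderEmbOfFin_apply]
    have h2 := List.getElem_of_eq h (i := k) (by simp [exponents])
    simpa [exponents] using h2.symm
  let e : ℕ → ℕ := fun i => if hi : i ∈ d.support then (o ⟨i, hi⟩ : ℕ) else 0
  let e' : ℕ → ℕ := fun i => if hi : i ∈ d'.support then (o.symm ⟨i, hi⟩ : ℕ) else 0
  have e_eq : ∀ i (hi : i ∈ d.support), e i = o ⟨i, hi⟩ := fun i hi => dif_pos hi
  have e'_eq : ∀ i (hi : i ∈ d'.support), e' i = o.symm ⟨i, hi⟩ := fun i hi => dif_pos hi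
  have he : StrictMonoOn e d.support := by
    intro i hi j hj hij
    rw [e_eq i hi, e_eq j hj]
    exact o.strictMono (a := ⟨i, hi⟩) (b := ⟨j, hj⟩) hij
  have he' : StrictMonoOn e' d'.support := by
    intro i hi j hj hij
    rw [e'_eq i hi, e'_eq j hj]
    exact o.symm.strictMono (a := ⟨i, hi⟩) (b := ⟨j, hj⟩) hij
  have hee : ∀ i ∈ d.support, e' (e i) = i := by
    intro i hi
    rw [e_eq i hi, e'_eq _ (o ⟨i, hi⟩).2]
    simp
  have hee' : ∀ i ∈ d'.support, e (e' i) = i := by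
    intro i hi
    rw [e'_eq i hi, e_eq _ (o.symm ⟨i, hi⟩).2]
    simp
  have hd : d.mapDomain e = d' := by
    ext j
    by_cases hj : j ∈ d'.support
    · have h3 : e' j ∈ d.support := by rw [e'_eq j hj]; exact (o.symm ⟨j, hj⟩).2
      have h4 := Finsupp.mapDomain_apply' (d.support : Set ℕ) d subset_rfl he.injOn h3
      rw [hee' j hj] at h4
      rw [h4, ← ho ⟨e' j, h3⟩, ← e_eq, hee' j hj]
    · rw [Finsupp.notMem_support_iff.mp hj, ← Finsupp.notMem_support_iff,
        Finsupp.mapDomain_support_of_injOn d he.injOn]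
      intro hm
      obtain ⟨i, hi, rfl⟩ := Finset.mem_image.mp hm
      exact hj (by rw [e_eq i hi]; exact (o ⟨i, hi⟩).2)
  refine ⟨e, e', he, he', hd, ?_, hee, hee'⟩
  rw [← hd, ← Finsupp.mapDomain_comp]
  conv_rhs => rw [← Finsupp.mapDomain_id (v := d)]
  exact Finsupp.mapDomain_congr fun i hi => hee i hi

theorem exists_exponents {n : ℕ} (α : Composition n) : ∃ d, exponents d = α.blocks := by
  classical
  have hpos : ∀ i (h : i < α.blocks.length), α.blocks[i] ≠ 0 := fun i h =>
    (α.blocks_pos (List.getElem_mem h)).ne'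
  have hs : α.blocks.toFinsupp.support = Finset.range α.blocks.length := by
    rw [List.toFinsupp_support]
    refine Finset.filter_true_of_mem fun i hi => ?_
    have hi' : i < α.blocks.length := by simpa using hi
    rw [List.getD_eq_getElem _ _ hi']
    exact hpos i hi'
  refine ⟨α.blocks.toFinsupp, ?_⟩
  rw [exponents, hs]
  have h1 : (Finset.range α.blocks.length).sort (· ≤ ·) = List.range α.blocks.length := by
    refine List.Perm.eq_of_pairwise' (r := (· ≤ ·)) (Finset.pairwise_sort _ _) ?_ ?_
    · exact List.pairwise_le_range
    · refine (List.perm_of_nodup_nodup_toFinset_eq (Finset.sort_nodup _ _) List.nodup_range ?_)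
      ext x; simp
  rw [h1]
  refine List.ext_getElem (by simp) fun i h1 h2 => ?_
  have h3 := List.getD_eq_getElem α.blocks 0 h2
  simpa using h3

variable (K : Type*) [Field K]

/-- The power series `M_α = ∑_{i₁ < ⋯ < i_k} x_{i₁}^{a₁} ⋯ x_{i_k}^{a_k}`: since the `a_j` are
positive, it is the sum, each with coefficient one, of the monomials whose nonzero exponents, in
the order of the variables, are `a₁, …, a_k`. -/
def monomialSeries {n : ℕ} (α : Composition n) : MvPowerSeries ℕ K :=
  fun d => if exponents d = α.blocks then 1 else 0

theorem coeff_monomialSeries {n : ℕ} (α : Composition n) (d : ℕ →₀ ℕ) :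
    MvPowerSeries.coeff d (monomialSeries K α) = if exponents d = α.blocks then 1 else 0 := rfl

/-- The linear span of the monomial quasisymmetric functions. -/
def qsymSpan : Submodule K (MvPowerSeries ℕ K) :=
  Submodule.span K (Set.range fun c : (Σ n, Composition n) => monomialSeries K c.2)

theorem mem_qsymSpan_iff (f : MvPowerSeries ℕ K) : f ∈ qsymSpan K ↔
    (∃ N, ∀ d : ℕ →₀ ℕ, N < d.degree → MvPowerSeries.coeff d f = 0) ∧
    ∀ d d', exponents d = exponents d' → MvPowerSeries.coeff d f = MvPowerSeries.coeff d' f := by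
  classical
  constructor
  · intro hf
    induction hf using Submodule.span_induction with
    | mem x hx =>
      obtain ⟨⟨n, α⟩, rfl⟩ := hx
      refine ⟨⟨n, fun d hd => ?_⟩, fun d d' h => by simp only [coeff_monomialSeries, h]⟩
      rw [coeff_monomialSeries, if_neg]
      intro h
      have := exponents_sum d
      rw [h, α.blocks_sum] at this
      omega
    | zero => simp
    | add x y _ _ hx hy =>
      obtain ⟨⟨N, hN⟩, h1⟩ := hx
      obtain ⟨⟨N', hN'⟩, h2⟩ := hy
      refine ⟨⟨max N N', fun d hd => ?_⟩, fun d d' h => ?_⟩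
      · rw [map_add, hN d (by omega), hN' d (by omega), add_zero]
      · rw [map_add, map_add, h1 d d' h, h2 d d' h]
    | smul a x _ hx =>
      obtain ⟨⟨N, hN⟩, h1⟩ := hx
      refine ⟨⟨N, fun d hd => ?_⟩, fun d d' h => ?_⟩
      · rw [map_smul, hN d hd, smul_zero]
      · rw [map_smul, map_smul, h1 d d' h]
  · rintro ⟨⟨N, hN⟩, h⟩
    choose std hstd using fun c : (Σ n, Composition n) => exists_exponents c.2
    have key : f = ∑ n ∈ Finset.range (N + 1), ∑ α : Composition n,
        MvPowerSeries.coeff (std ⟨n, α⟩) f • monomialSeries K α := by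
      ext d
      simp only [map_sum, map_smul, coeff_monomialSeries, smul_eq_mul, mul_ite, mul_one, mul_zero]
      let c : Composition d.degree := ⟨exponents d, fun h => exponents_pos d h, exponents_sum d⟩
      have hne : ∀ n, n ≠ d.degree → ∀ α : Composition n, exponents d ≠ α.blocks := by
        intro n hn α hα
        have := exponents_sum d
        rw [hα, α.blocks_sum] at this
        exact hn this
      have hsum : (∑ α : Composition d.degree,
          if exponents d = α.blocks then MvPowerSeries.coeff (std ⟨d.degree, α⟩) f else 0)
          = MvPowerSeries.coeff d f := by
        rw [Finset.sum_eq_single c]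
        · rw [if_pos rfl]
          exact h _ _ (hstd ⟨d.degree, c⟩)
        · intro α _ hα
          rw [if_neg]
          intro hh
          exact hα (Composition.ext hh.symm)
        · intro hc
          exact absurd (Finset.mem_univ _) hc
      by_cases hd : d.degree ∈ Finset.range (N + 1)
      · rw [Finset.sum_eq_single_of_mem d.degree hd, hsum]
        intro n _ hn
        exact Finset.sum_eq_zero fun α _ => if_neg (hne n hn α)
      · rw [hN d (by simpa using hd)]
        refine (Finset.sum_eq_zero fun n hn => ?_).symm
        have hn' : n ≠ d.degree := by rintro rfl; exact hd hn
        exact Finset.sum_eq_zero fun α _ => if_neg (hne n hn' α)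
    rw [key]
    refine Submodule.sum_mem _ fun n _ => Submodule.sum_mem _ fun α _ => ?_
    exact Submodule.smul_mem _ _ (Submodule.subset_span ⟨⟨n, α⟩, rfl⟩)

theorem one_mem_qsymSpan : (1 : MvPowerSeries ℕ K) ∈ qsymSpan K := by
  classical
  have h0 : ∀ d : ℕ →₀ ℕ, exponents d = [] ↔ d = 0 := by
    intro d
    rw [exponents, List.map_eq_nil_iff]
    constructor
    · intro h
      rw [← Finsupp.support_eq_empty, ← Finset.card_eq_zero, ← Finset.length_sort (· ≤ ·), h]
      rfl
    · rintro rfl; simp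
  refine Submodule.subset_span ⟨⟨0, Composition.ones 0⟩, ?_⟩
  ext d
  rw [coeff_monomialSeries, MvPowerSeries.coeff_one]
  simp [Composition.ones, h0]

theorem mul_mem_qsymSpan {f g : MvPowerSeries ℕ K} (hf : f ∈ qsymSpan K) (hg : g ∈ qsymSpan K) :
    f * g ∈ qsymSpan K := by
  classical
  rw [mem_qsymSpan_iff] at *
  obtain ⟨⟨N, hN⟩, h1⟩ := hf
  obtain ⟨⟨N', hN'⟩, h2⟩ := hg
  refine ⟨⟨N + N', fun d hd => ?_⟩, fun d d' h => ?_⟩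
  · rw [MvPowerSeries.coeff_mul]
    refine Finset.sum_eq_zero fun p hp => ?_
    rw [Finset.HasAntidiagonal.mem_antidiagonal] at hp
    have : d.degree = p.1.degree + p.2.degree := by rw [← hp, map_add]
    rcases lt_or_ge N p.1.degree with h3 | h3
    · rw [hN _ h3, zero_mul]
    · rw [hN' _ (by omega), mul_zero]
  · obtain ⟨e, e', he, he', hd, hd', hee, hee'⟩ := exists_transport h
    have back : ∀ (u v : ℕ → ℕ) (D : ℕ →₀ ℕ), (∀ i ∈ D.support, v (u i) = i) →
        ∀ p : ℕ →₀ ℕ, p.support ⊆ D.support → (p.mapDomain u).mapDomain v = p := by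
      intro u v D huv p hp
      rw [← Finsupp.mapDomain_comp]
      conv_rhs => rw [← Finsupp.mapDomain_id (v := p)]
      exact Finsupp.mapDomain_congr fun i hi => huv i (hp hi)
    have sub : ∀ {D : ℕ →₀ ℕ} {p : (ℕ →₀ ℕ) × (ℕ →₀ ℕ)}, p ∈ Finset.HasAntidiagonal.antidiagonal D →
        p.1.support ⊆ D.support ∧ p.2.support ⊆ D.support := by
      intro D p hp
      rw [Finset.HasAntidiagonal.mem_antidiagonal] at hp
      subst hp
      constructor <;> intro i hi <;> simp at hi ⊢ <;> omega
    rw [MvPowerSeries.coeff_mul, MvPowerSeries.coeff_mul]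
    refine Finset.sum_bij' (fun p _ => (p.1.mapDomain e, p.2.mapDomain e))
      (fun p _ => (p.1.mapDomain e', p.2.mapDomain e')) ?_ ?_ ?_ ?_ ?_
    · intro p hp
      rw [Finset.HasAntidiagonal.mem_antidiagonal] at hp ⊢
      rw [← Finsupp.mapDomain_add, hp, hd]
    · intro p hp
      rw [Finset.HasAntidiagonal.mem_antidiagonal] at hp ⊢
      rw [← Finsupp.mapDomain_add, hp, hd']
    · intro p hp
      exact Prod.ext (back e e' d hee _ (sub hp).1) (back e e' d hee _ (sub hp).2)
    · intro p hp
      exact Prod.ext (back e' e d' hee' _ (sub hp).1) (back e' e d' hee' _ (sub hp).2)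
    · intro p hp
      congr 1
      · refine h1 _ _ (exponents_mapDomain e p.1 (he.mono ?_)).symm
        exact_mod_cast (sub hp).1
      · refine h2 _ _ (exponents_mapDomain e p.2 (he.mono ?_)).symm
        exact_mod_cast (sub hp).2

/-- The algebra `𝒬` of quasisymmetric functions over `K`. -/
def QSym : Subalgebra K (MvPowerSeries ℕ K) where
  __ := qsymSpan K
  mul_mem' := mul_mem_qsymSpan K
  one_mem' := one_mem_qsymSpan K
  algebraMap_mem' r := by
    rw [Algebra.algebraMap_eq_smul_one]
    exact Submodule.smul_mem _ _ (one_mem_qsymSpan K)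

theorem linearIndependent_monomialSeries :
    LinearIndependent K (fun c : (Σ n, Composition n) => monomialSeries K c.2) := by
  classical
  rw [linearIndependent_iff']
  intro s g hg c hc
  obtain ⟨d, hd⟩ := exists_exponents c.2
  have h := congrArg (MvPowerSeries.coeff d) hg
  rw [map_sum, map_zero, Finset.sum_eq_single_of_mem c hc] at h
  · simpa [coeff_monomialSeries, hd] using h
  · rintro ⟨n, α⟩ _ hne
    rw [map_smul, coeff_monomialSeries, if_neg, smul_zero]
    rw [hd]
    obtain ⟨m, β⟩ := c
    dsimp only
    intro hb
    have hmn : m = n := by rw [← α.blocks_sum, ← β.blocks_sum, hb]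
    subst hmn
    exact hne (by rw [Composition.ext hb])

/-- The basis `(M_α)` of `𝒬`, indexed by the compositions `α` of all `n ≥ 0`. -/
def monomialBasis : Module.Basis (Σ n, Composition n) K (QSym K) :=
  Module.Basis.span (linearIndependent_monomialSeries K)

/-- The monomial quasisymmetric function `M_α`. -/
def M {n : ℕ} (α : Composition n) : QSym K := monomialBasis K ⟨n, α⟩

theorem coe_M {n : ℕ} (α : Composition n) :
    (M K α : MvPowerSeries ℕ K) = monomialSeries K α :=
  congrArg Subtype.val
    (Module.Basis.span_apply (linearIndependent_monomialSeries K) (⟨n, α⟩ : Σ n, Composition n))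

/-- The descent set `{i ∈ [n-1] : σ_i > σ_{i+1}}` of a permutation of `[n]`. As `Fin n` is
zero-based, the letters `σ_i` and `σ_{i+1}` are the values of `σ` at `i - 1` and at `i`. -/
def descents {n : ℕ} (σ : Equiv.Perm (Fin n)) : Finset ℕ :=
  (Finset.range n).filter fun i =>
    ∃ (h₀ : 0 < i) (h : i < n), σ ⟨i, h⟩ < σ ⟨i - 1, (Nat.sub_lt h₀ one_pos).trans h⟩

/-- The subset `S_α = {a₁, a₁ + a₂, …, a₁ + ⋯ + a_{k-1}}` of `[n-1]` of a composition
`α = (a₁, …, a_k)` of `n`. -/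
def cuts {n : ℕ} (α : Composition n) : Finset ℕ :=
  (Finset.Ioo 0 α.length).image α.sizeUpTo

theorem mem_cuts {n : ℕ} (α : Composition n) (i : ℕ) :
    i ∈ cuts α ↔ 0 < i ∧ i < n ∧ ∃ j, α.sizeUpTo j = i := by
  simp only [cuts, Finset.mem_image, Finset.mem_Ioo]
  constructor
  · rintro ⟨j, ⟨h0, h1⟩, rfl⟩
    refine ⟨?_, ?_, j, rfl⟩
    · have h2 := α.sizeUpTo_strict_mono (i := 0) (by omega)
      rw [Composition.sizeUpTo_zero] at h2
      exact h2.trans_le (α.monotone_sizeUpTo h0)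
    · exact (α.sizeUpTo_strict_mono h1).trans_le (α.sizeUpTo_le _)
  · rintro ⟨h0, h1, j, rfl⟩
    refine ⟨j, ⟨?_, ?_⟩, rfl⟩
    · rcases Nat.eq_zero_or_pos j with rfl | h
      · rw [Composition.sizeUpTo_zero] at h0; omega
      · exact h
    · by_contra h
      rw [α.sizeUpTo_ofLength_le j (by omega)] at h1
      omega

theorem cuts_injective (n : ℕ) : Function.Injective (cuts (n := n)) := by
  have hb : ∀ (α : Composition n) (i : Fin (n + 1)),
      i ∈ α.boundaries ↔ i = 0 ∨ i = Fin.last n ∨ (i : ℕ) ∈ cuts α := by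
    intro α i
    constructor
    · intro h
      obtain ⟨j, -, hj⟩ := Finset.mem_map.mp h
      by_cases h0 : i = 0
      · exact Or.inl h0
      by_cases h1 : i = Fin.last n
      · exact Or.inr (Or.inl h1)
      refine Or.inr (Or.inr ((mem_cuts α i).mpr ⟨?_, ?_, j, ?_⟩))
      · exact Nat.pos_of_ne_zero fun h => h0 (Fin.ext h)
      · exact lt_of_le_of_ne (Nat.lt_succ_iff.mp i.2) fun h => h1 (Fin.ext h)
      · exact congrArg Fin.val hj
    · rintro (rfl | rfl | h)
      · exact α.toCompositionAsSet.zero_mem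
      · exact α.toCompositionAsSet.getLast_mem
      · simp only [cuts, Finset.mem_image, Finset.mem_Ioo] at h
        obtain ⟨j, hj, hji⟩ := h
        exact Finset.mem_map.mpr ⟨⟨j, by omega⟩, Finset.mem_univ _, Fin.ext hji⟩
  intro α β h
  have h1 : α.boundaries = β.boundaries := by
    ext i
    rw [hb, hb, h]
  exact (compositionEquiv n).injective (CompositionAsSet.ext h1)

theorem exists_descents_eq_cuts {n : ℕ} (α : Composition n) :
    ∃ σ : Equiv.Perm (Fin n), descents σ = cuts α := by
  let f : Fin n → ℕ := fun i => (α.length - α.index i) * n + i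
  have hlt : ∀ i j : Fin n, f i < f j ↔
      (α.index j < α.index i ∨ α.index i = α.index j ∧ i < j) := by
    intro i j
    have key : ∀ i j : Fin n, α.index j < α.index i → f i < f j := by
      intro i j h
      have h1 : α.length - (α.index i : ℕ) + 1 ≤ α.length - (α.index j : ℕ) := by
        have := (α.index i).2
        have h2 : (α.index j : ℕ) < α.index i := h
        omega
      calc f i < (α.length - (α.index i : ℕ)) * n + n := Nat.add_lt_add_left i.2 _
        _ = (α.length - (α.index i : ℕ) + 1) * n := by ring
        _ ≤ (α.length - (α.index j : ℕ)) * n := Nat.mul_le_mul_right _ h1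
        _ ≤ f j := Nat.le_add_right _ _
    rcases lt_trichotomy (α.index i) (α.index j) with h | h | h
    · have h1 := key j i h
      constructor
      · intro h2; omega
      · rintro (h2 | ⟨h2, -⟩)
        · exact absurd h2 h.asymm
        · exact absurd h2 h.ne
    · simp [f, h]
    · exact ⟨fun _ => Or.inl h, fun _ => key i j h⟩
  have hinj : Function.Injective f := by
    intro i j h
    by_contra hne
    have h1 : ¬ f i < f j := by omega
    have h2 : ¬ f j < f i := by omega
    rw [hlt] at h1 h2
    push Not at h1 h2
    have h3 : α.index i = α.index j := le_antisymm h1.1 h2.1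
    exact hne (le_antisymm (h2.2 h3.symm) (h1.2 h3))
  have hmono : StrictMono (f ∘ Tuple.sort f) :=
    (Tuple.monotone_sort f).strictMono_of_injective (hinj.comp (Tuple.sort f).injective)
  have hσ : ∀ i j, (Tuple.sort f)⁻¹ i < (Tuple.sort f)⁻¹ j ↔ f i < f j := by
    intro i j
    rw [← hmono.lt_iff_lt]
    simp
  refine ⟨(Tuple.sort f)⁻¹, ?_⟩
  ext i
  rw [mem_cuts]
  simp only [descents, Finset.mem_filter, Finset.mem_range, hσ, hlt]
  constructor
  · rintro ⟨hi, h0, _, h⟩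
    refine ⟨h0, hi, ?_⟩
    rcases h with h | ⟨-, h⟩
    · refine ⟨α.index ⟨i, hi⟩, le_antisymm (α.sizeUpTo_index_le ⟨i, hi⟩) ?_⟩
      have h1 := α.lt_sizeUpTo_index_succ ⟨i - 1, by omega⟩
      have h2 := α.monotone_sizeUpTo (show (α.index ⟨i - 1, by omega⟩ : ℕ) + 1 ≤
        α.index ⟨i, hi⟩ from h)
      simp only [Fin.val_succ] at h1
      omega
    · have : i < i - 1 := h
      omega
  · rintro ⟨h0, hi, j, hj⟩
    refine ⟨hi, h0, hi, Or.inl ?_⟩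
    have h1 := α.sizeUpTo_index_le ⟨i - 1, by omega⟩
    have h2 := α.lt_sizeUpTo_index_succ ⟨i, hi⟩
    simp only [Fin.val_succ] at h1 h2
    have h3 : (α.index ⟨i - 1, by omega⟩ : ℕ) < j := by
      by_contra h
      have := α.monotone_sizeUpTo (not_lt.mp h)
      omega
    have h4 : j < (α.index ⟨i, hi⟩ : ℕ) + 1 := by
      by_contra h
      have := α.monotone_sizeUpTo (not_lt.mp h)
      omega
    exact Fin.lt_def.mpr (by omega)

/-- The sum `X_α` in the group algebra of all permutations `σ` with `D(σ) ≤ α`, that is, with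
descent set contained in `S_α`. -/
def xSum {n : ℕ} (α : Composition n) : MonoidAlgebra K (Equiv.Perm (Fin n)) :=
  ∑ σ : Equiv.Perm (Fin n) with descents σ ⊆ cuts α, MonoidAlgebra.of K _ σ

theorem linearIndependent_xSum (n : ℕ) :
    LinearIndependent K (fun α : Composition n => xSum K α) := by
  classical
  choose τ hτ using fun α : Composition n => exists_descents_eq_cuts α
  have hcoef : ∀ α β : Composition n,
      (xSum K α).coeff (τ β) = if cuts β ⊆ cuts α then 1 else 0 := by
    intro α β
    simp [xSum, hτ, Finsupp.single_apply, MonoidAlgebra.of_apply]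
  rw [Fintype.linearIndependent_iff]
  intro g hg
  have main : ∀ k, ∀ β : Composition n, n - (cuts β).card = k → g β = 0 := by
    intro k
    induction k using Nat.strong_induction_on with
    | _ k ih =>
      intro β hβ
      have h := congrArg (fun w : MonoidAlgebra K (Equiv.Perm (Fin n)) => w.coeff (τ β)) hg
      simp only [MonoidAlgebra.coeff_sum, MonoidAlgebra.coeff_smul, Finsupp.finsetSum_apply,
        Finsupp.smul_apply, hcoef, MonoidAlgebra.coeff_zero, Finsupp.zero_apply, smul_eq_mul] at h
      rw [Finset.sum_eq_single_of_mem β (Finset.mem_univ _)] at h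
      · simpa using h
      · intro α _ hα
        by_cases hs : cuts β ⊆ cuts α
        · have hlt : (cuts β).card < (cuts α).card :=
            Finset.card_lt_card (hs.ssubset_of_ne fun e => hα (cuts_injective n e).symm)
          have hle : (cuts α).card ≤ n := by
            have hsub : cuts α ⊆ Finset.range n := fun i hi =>
              Finset.mem_range.mpr ((mem_cuts α i).mp hi).2.1
            simpa using Finset.card_le_card hsub
          rw [ih _ (by omega) α rfl, zero_mul]
        · rw [if_neg hs, mul_zero]
  exact fun β => main _ β rfl

/-- The descent algebra `𝒟_n`: the subspace of the group algebra spanned by the `X_α`. -/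
def descentAlgebra (n : ℕ) : Submodule K (MonoidAlgebra K (Equiv.Perm (Fin n))) :=
  Submodule.span K (Set.range fun α : Composition n => xSum K α)

/-- The basis `(X_α)` of `𝒟_n`. -/
def xBasis (n : ℕ) : Module.Basis (Composition n) K (descentAlgebra K n) :=
  Module.Basis.span (linearIndependent_xSum K n)

theorem coe_xBasis {n : ℕ} (α : Composition n) :
    (xBasis K n α : MonoidAlgebra K (Equiv.Perm (Fin n))) = xSum K α :=
  congrArg Subtype.val (Module.Basis.span_apply (linearIndependent_xSum K n) α)

/-- The homogeneous component `𝒬_n`, spanned by the `M_α` with `α` a composition of `n`. -/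
def degreePart (n : ℕ) : Submodule K (QSym K) :=
  Submodule.span K (Set.range fun α : Composition n => M K α)

theorem M_mem_degreePart {n : ℕ} (α : Composition n) : M K α ∈ degreePart K n :=
  Submodule.subset_span ⟨α, rfl⟩

/-- The composition formed by the first `j` parts of `α`. -/
def takeParts {n : ℕ} (α : Composition n) (j : ℕ) : Composition (α.blocks.take j).sum :=
  ⟨α.blocks.take j, fun h => α.blocks_pos (List.mem_of_mem_take h), rfl⟩

/-- The composition formed by all but the first `j` parts of `α`. -/
def dropParts {n : ℕ} (α : Composition n) (j : ℕ) : Composition (α.blocks.drop j).sum :=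
  ⟨α.blocks.drop j, fun h => α.blocks_pos (List.mem_of_mem_drop h), rfl⟩

/-- The coproduct of `𝒬`: `Δ(M_α) = ∑ M_β ⊗ M_γ`, over all ways of writing `α` as the
concatenation of two possibly empty compositions `β` and `γ`. -/
def comul : QSym K →ₗ[K] QSym K ⊗[K] QSym K :=
  (monomialBasis K).constr K fun c =>
    ∑ j ∈ Finset.range (c.2.length + 1), M K (takeParts c.2 j) ⊗ₜ[K] M K (dropParts c.2 j)

/-- The counit of `𝒬`: the coefficient of `M_()`. -/
def counit : QSym K →ₗ[K] K :=
  (monomialBasis K).constr K fun c => if c.2.length = 0 then 1 else 0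

/-- The endomorphisms of the graded Hopf algebra `𝒬`: the degree-preserving algebra endomorphisms
that are compatible with coproduct and counit. (Compatibility with the antipode is automatic.) -/
structure QSymEnd where
  toAlgHom : QSym K →ₐ[K] QSym K
  map_comul : comul K ∘ₗ toAlgHom.toLinearMap =
    TensorProduct.map toAlgHom.toLinearMap toAlgHom.toLinearMap ∘ₗ comul K
  map_counit : counit K ∘ₗ toAlgHom.toLinearMap = counit K
  map_degree : ∀ n, ∀ f ∈ degreePart K n, toAlgHom f ∈ degreePart K n

variable {K}

/-- The restriction `Φ_n` of `Φ` to `𝒬_n`. -/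
def QSymEnd.degreeMap (Φ : QSymEnd K) (n : ℕ) : Module.End K (degreePart K n) :=
  Φ.toAlgHom.toLinearMap.restrict (Φ.map_degree n)

variable (K) in
/-- The space `∏_n 𝒟_n` of formal series `∑ W_n` with `W_n ∈ 𝒟_n`. -/
abbrev DescentSeries := ∀ n : ℕ, descentAlgebra K n

/-- The pairing `⟨W, G⟩` of a series `W` with a quasisymmetric function `G`, determined by
`⟨X_α, M_β⟩ = δ_{α,β}`: thus `⟨W, M_β⟩` is the coefficient of `X_β` in `W_n` if `β` is a
composition of `n`. -/
def pairing (W : DescentSeries K) : QSym K →ₗ[K] K :=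
  (monomialBasis K).constr K fun c => (xBasis K c.1).repr (W c.1) c.2

theorem pairing_M (W : DescentSeries K) {n : ℕ} (α : Composition n) :
    pairing W (M K α) = (xBasis K n).repr (W n) α :=
  (monomialBasis K).constr_basis K _ ⟨n, α⟩

/-- The composition of `n` with at most one part: `(n)` if `n > 0`, and `()` if `n = 0`. -/
def onePart : ∀ n : ℕ, Composition n
  | 0 => Composition.ones 0
  | n + 1 => Composition.single (n + 1) n.succ_pos

variable (K) in
/-- The universal character `X = ∑ X_n`. -/
def universalCharacter : DescentSeries K := fun n => xBasis K n (onePart n)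

/-- The series `W^Φ` with `⟨W^Φ, G⟩ = ⟨W, Φ(G)⟩` for all `G`. -/
def twist (Φ : QSymEnd K) (W : DescentSeries K) : DescentSeries K := fun n =>
  ∑ α : Composition n, pairing W (Φ.toAlgHom (M K α)) • xBasis K n α

theorem pairing_injective : Function.Injective (pairing (K := K)) := by
  intro W V h
  funext n
  refine (xBasis K n).repr.injective (Finsupp.ext fun α => ?_)
  rw [← pairing_M, ← pairing_M, h]

theorem pairing_twist (Φ : QSymEnd K) (W : DescentSeries K) :
    pairing (twist Φ W) = pairing W ∘ₗ Φ.toAlgHom.toLinearMap := by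
  classical
  refine (monomialBasis K).ext fun c => ?_
  obtain ⟨n, α⟩ := c
  change pairing (twist Φ W) (M K α) = pairing W (Φ.toAlgHom (M K α))
  rw [pairing_M]
  simp [twist, Finsupp.single_apply]

/-- The character `X^Φ`, as a series; its component in degree `n` is `(X^Φ)_n ∈ 𝒟_n`. -/
def charSeries (Φ : QSymEnd K) : DescentSeries K := twist Φ (universalCharacter K)

/-- `λ_m = ⟨X^Φ, M_m⟩`. -/
def lam (Φ : QSymEnd K) (m : ℕ) : K := pairing (charSeries Φ) (M K (onePart m))

/-- `λ_α = λ_{a₁} ⋯ λ_{a_k}` for `α = (a₁, …, a_k)`. -/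
def lamComp (Φ : QSymEnd K) {n : ℕ} (α : Composition n) : K := (α.blocks.map (lam Φ)).prod

open Classical in
/-- The pairing `⟨w, M_β⟩` for an element `w` of the group algebra that lies in `𝒟_n`, which is
the coefficient of `X_β` in `w`; it is given the value zero if `w` does not lie in `𝒟_n`. -/
def pairingM {n : ℕ} (w : MonoidAlgebra K (Equiv.Perm (Fin n))) (β : Composition n) : K :=
  if h : w ∈ descentAlgebra K n then (xBasis K n).repr ⟨w, h⟩ β else 0

open Classical in
/-- The coefficients `⟨Z_m, M_β⟩` of `Z_m`, by recursion on the refinement order of the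
compositions of `m` (`α < β` if `S_α` is a proper subset of `S_β`):
`⟨Z_m, M_m⟩ = 1`, and for `β ≠ (m)`
`⟨Z_m, M_β⟩ = (λ_m - λ_β)⁻¹ ∑_{α < β} ⟨Z_m, M_α⟩ ⟨X^Φ · X_α, M_β⟩`,
with `·` the product of the group algebra. -/
def zCoeff (Φ : QSymEnd K) (m : ℕ) (β : Composition m) : K :=
  if β = onePart m then 1
  else (lam Φ m - lamComp Φ β)⁻¹ * ∑ α : {α : Composition m // cuts α ⊂ cuts β},
    zCoeff Φ m α.1 *
      pairingM ((charSeries Φ m : MonoidAlgebra K (Equiv.Perm (Fin m))) * xSum K α.1) β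
termination_by (cuts β).card
decreasing_by exact Finset.card_lt_card α.2

/-- The element `Z_m = ∑_β ⟨Z_m, M_β⟩ X_β` of `𝒟_m`. -/
def zElem (Φ : QSymEnd K) (m : ℕ) : descentAlgebra K m :=
  ∑ β : Composition m, zCoeff Φ m β • xBasis K m β

variable (K) in
/-- The direct sum `𝒟 = ⨁_n 𝒟_n`. -/
abbrev DescentSum := Π₀ n : ℕ, descentAlgebra K n

variable (K) in
/-- The bilinear product `⋆` on `𝒟`, given by `X_α ⋆ X_β = X_{α·β}`, where `α·β` is the
concatenation of `α` and `β`. -/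
def starMul : DescentSum K →ₗ[K] DescentSum K →ₗ[K] DescentSum K :=
  (DFinsupp.basis (xBasis K)).constr K fun a =>
    (DFinsupp.basis (xBasis K)).constr K fun b =>
      DFinsupp.single (a.1 + b.1) (xBasis K (a.1 + b.1) (a.2.append b.2))

/-- The element `Z_α = Z_{a₁} ⋆ ⋯ ⋆ Z_{a_k}` of `𝒟_n`, for `α = (a₁, …, a_k)` a composition of
`n`; the empty product is the unit `X_()` of `⋆`. -/
def zComp (Φ : QSymEnd K) {n : ℕ} (α : Composition n) : descentAlgebra K n :=
  ((α.blocks.map fun a => DFinsupp.single a (zElem Φ a)).foldr (fun u v => starMul K u v)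
    (DFinsupp.single 0 (xBasis K 0 (onePart 0))) : DescentSum K) n

/-- Left multiplication by `w` in the group algebra, as an operator on `𝒟_n`, provided that it
maps `𝒟_n` to itself. -/
def leftMul {n : ℕ} (w : MonoidAlgebra K (Equiv.Perm (Fin n)))
    (hw : ∀ v ∈ descentAlgebra K n, w * v ∈ descentAlgebra K n) :
    Module.End K (descentAlgebra K n) :=
  (LinearMap.mulLeft K w).restrict hw

/-- A linear operator is diagonalizable if its eigenspaces span the whole space. -/
def IsDiagonalizable {V : Type*} [AddCommGroup V] [Module K V] (T : Module.End K V) : Prop :=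
  (⨆ μ : K, Module.End.eigenspace T μ) = ⊤

end QSymWalk
end

open QSymWalk

/-!
The proof rests on one fact: in the bases `(X_α)` of `𝒟_n` and `(M_α)` of `𝒬_n`, dual to each other
for the pairing, left multiplication by `(X^Φ)_n` is the transpose of `Φ_n` (`charMul_xBasis`).

Write `c(α, β)` for the coefficient of `M_β` in `Φ(M_α)` (`transition`). The coefficient of a
permutation `π` in `∑_α c(α, β) X_α` is the coefficient of `M_β` in `Φ(F_π)`, where `F_π` is the
fundamental quasisymmetric function of the descents of `π`. Since `Φ` respects coproducts, this is
the product of the values of the character at the functions `F_{π_i}`, where `π = π_1 ⋯ π_k` is cut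
into factors of lengths `β`; since `Φ` respects products, it is the value of the character at
`∏ F_{π_i}` (`coef_map_fundamental_eq`). That product is the sum of `F_{π τ⁻¹}` over all `τ`
whose descents belong to `S_β` (`sum_fundamental_eq_fundamentalProd`): both sides enumerate the
words `f` for which the pairs `(f i, π i)` increase lexicographically within each factor, and `τ` is
found by sorting these pairs (`sum_count_compatible`). So the coefficient is that of `π`
in `(X^Φ)_n · X_β`.

Compatibility with the coproduct then says that left multiplication by `X^Φ` is an endomorphism
for `⋆` (`charMulSum_starMul`). The recursion defining `Z_m` is the coordinate form of
`X^Φ · Z_m = λ_m Z_m`, because the matrix `c` is triangular for refinement with diagonal entries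
`λ_α`; hence `Z_α` is an eigenvector for `λ_α` (`charMul_zComp`). The `Z_α` are independent since
`Z_α` is `X_α` up to terms with more parts. By the hypothesis on the rank, those with `λ_α ≠ 0`
form a basis of the range of the operator, which makes the operator diagonalizable and determines
its eigenspaces for nonzero values (`isDiagonalizable_of_finrank_range`); its transpose `Φ_n` is
then diagonalizable as well.
-/

noncomputable section
namespace QSymWalk
variable (K : Type*) [Field K]

/-! ### Coefficients of quasisymmetric functions, indexed by lists -/

/-- `M_l` for a list `l` of positive integers; the value is zero if `l` has a zero entry. Lists
spare the transport between `Composition m` and `Composition n` when `m = n`. -/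
def monomialOfList (l : List ℕ) : QSym K :=
  if h : ∀ a ∈ l, 0 < a then M K (⟨l, fun ha => h _ ha, rfl⟩ : Composition l.sum) else 0

/-- The coefficient of `M_l`; the zero functional if `l` has a zero entry. -/
def coefOfList (l : List ℕ) : QSym K →ₗ[K] K :=
  if h : ∀ a ∈ l, 0 < a then
    (monomialBasis K).coord ⟨l.sum, ⟨l, fun ha => h _ ha, rfl⟩⟩
  else 0

theorem sigma_composition_ext {c c' : Σ n, Composition n} (h : c.2.blocks = c'.2.blocks) :
    c = c' := by
  obtain ⟨n, α⟩ := c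
  obtain ⟨m, β⟩ := c'
  dsimp only at h
  have hmn : n = m := by rw [← α.blocks_sum, ← β.blocks_sum, h]
  subst hmn
  rw [Composition.ext h]

theorem monomialOfList_blocks {n : ℕ} (α : Composition n) :
    monomialOfList K α.blocks = M K α := by
  rw [monomialOfList, dif_pos fun a ha => α.blocks_pos ha]
  exact congrArg (monomialBasis K) (sigma_composition_ext rfl)

theorem coefOfList_M (l : List ℕ) {n : ℕ} (α : Composition n) :
    coefOfList K l (M K α) = if α.blocks = l then 1 else 0 := by
  classical
  by_cases h : ∀ a ∈ l, 0 < a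
  · rw [coefOfList, dif_pos h, M, Module.Basis.coord_apply, Module.Basis.repr_self,
      Finsupp.single_apply]
    refine if_congr ⟨fun hc => ?_, fun hl => sigma_composition_ext hl⟩ rfl rfl
    exact congrArg (fun c : Σ n, Composition n => c.2.blocks) hc
  · rw [coefOfList, dif_neg h, if_neg]
    · rfl
    · rintro rfl
      exact h fun a ha => α.blocks_pos ha

theorem coefOfList_eq_coeff {l : List ℕ} {d : ℕ →₀ ℕ} (h : exponents d = l) (G : QSym K) :
    coefOfList K l G = MvPowerSeries.coeff d (G : MvPowerSeries ℕ K) := by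
  have key : coefOfList K l = MvPowerSeries.coeff d ∘ₗ (QSym K).val.toLinearMap := by
    refine (monomialBasis K).ext fun c => ?_
    change coefOfList K l (M K c.2) = MvPowerSeries.coeff d (M K c.2 : MvPowerSeries ℕ K)
    rw [coefOfList_M, coe_M, coeff_monomialSeries, h]
    exact if_congr eq_comm rfl rfl
  exact congrArg (fun φ : QSym K →ₗ[K] K => φ G) key

theorem coefOfList_eq_zero_of_degree {n : ℕ} {G : QSym K} (hG : G ∈ degreePart K n)
    {l : List ℕ} (hl : l.sum ≠ n) : coefOfList K l G = 0 := by
  have : degreePart K n ≤ LinearMap.ker (coefOfList K l) := by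
    refine Submodule.span_le.mpr ?_
    rintro _ ⟨α, rfl⟩
    change coefOfList K l (M K α) = 0
    rw [coefOfList_M, if_neg]
    rintro rfl
    exact hl α.blocks_sum
  exact this hG

theorem eq_sum_coefOfList {n : ℕ} {G : QSym K} (hG : G ∈ degreePart K n) :
    G = ∑ α : Composition n, coefOfList K α.blocks G • M K α := by
  classical
  induction hG using Submodule.span_induction with
  | mem x hx =>
    obtain ⟨α, rfl⟩ := hx
    simp [coefOfList_M, Composition.ext_iff.symm]
  | zero => simp
  | add x y _ _ hx hy =>
    simp only [map_add, add_smul, Finset.sum_add_distrib]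
    rw [← hx, ← hy]
  | smul a x _ hx =>
    simp only [map_smul, smul_assoc, ← Finset.smul_sum]
    rw [← hx]

/-- The coefficients of the coproduct: extracting the coefficient of `M_l ⊗ M_{l'}` from `Δ(G)`
amounts to extracting the coefficient of `M_{l·l'}` from `G`. -/
theorem coefOfList_append (l l' : List ℕ) (G : QSym K) :
    coefOfList K (l ++ l') G = LinearMap.mul' K K
      (TensorProduct.map (coefOfList K l) (coefOfList K l') (comul K G)) := by
  have key : coefOfList K (l ++ l') = LinearMap.mul' K K ∘ₗ
      TensorProduct.map (coefOfList K l) (coefOfList K l') ∘ₗ comul K := by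
    refine (monomialBasis K).ext fun c => ?_
    obtain ⟨n, α⟩ := c
    change coefOfList K (l ++ l') (M K α) = LinearMap.mul' K K
      (TensorProduct.map (coefOfList K l) (coefOfList K l') (comul K (monomialBasis K ⟨n, α⟩)))
    rw [comul, Module.Basis.constr_basis]
    simp only [map_sum, TensorProduct.map_tmul, LinearMap.mul'_apply]
    have hterm : ∀ j, coefOfList K l (M K (takeParts α j)) * coefOfList K l' (M K (dropParts α j))
        = if α.blocks.take j = l ∧ α.blocks.drop j = l' then 1 else 0 := by
      intro j
      rw [coefOfList_M, coefOfList_M, ite_and]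
      change (if α.blocks.take j = l then (1 : K) else 0) *
        (if α.blocks.drop j = l' then 1 else 0) = _
      rw [ite_zero_mul, one_mul]
    rw [Finset.sum_congr rfl fun j _ => hterm j, coefOfList_M]
    by_cases h : α.blocks = l ++ l'
    · have hlen : α.length = l.length + l'.length := by
        rw [← List.length_append, ← h]
      rw [if_pos h, Finset.sum_eq_single l.length]
      · simp [h]
      · intro j hj hne
        rw [if_neg]
        rintro ⟨ht, -⟩
        have := congrArg List.length ht
        rw [List.length_take, h, List.length_append] at this
        rw [Finset.mem_range] at hj
        omega
      · intro hn
        exact absurd (Finset.mem_range.mpr (by omega)) hn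
    · rw [if_neg h]
      refine (Finset.sum_eq_zero fun j _ => if_neg ?_).symm
      rintro ⟨h1, h2⟩
      exact h (by rw [← h1, ← h2, List.take_append_drop])
  exact congrArg (fun φ : QSym K →ₗ[K] K => φ G) key

theorem exponents_single (k : ℕ) : exponents (Finsupp.single 0 k) = (onePart k).blocks := by
  cases k with
  | zero => simp [exponents, onePart, Composition.ones]
  | succ k =>
    have : (Finsupp.single 0 (k + 1) : ℕ →₀ ℕ).support = {0} :=
      Finsupp.support_single 0 k.succ_ne_zero
    rw [exponents, this, Finset.sort_singleton]
    simp [onePart, Composition.single]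

/-- Setting all variables but the first to zero is multiplicative. -/
theorem coefOfList_onePart_mul (n : ℕ) (f g : QSym K) :
    coefOfList K (onePart n).blocks (f * g) = ∑ p ∈ Finset.HasAntidiagonal.antidiagonal n,
      coefOfList K (onePart p.1).blocks f * coefOfList K (onePart p.2).blocks g := by
  classical
  rw [coefOfList_eq_coeff K (exponents_single n)]
  change MvPowerSeries.coeff _ ((f : MvPowerSeries ℕ K) * (g : MvPowerSeries ℕ K)) = _
  rw [MvPowerSeries.coeff_mul, Finsupp.antidiagonal_single, Finset.sum_map]
  refine Finset.sum_congr rfl fun p _ => ?_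
  rw [coefOfList_eq_coeff K (exponents_single p.1), coefOfList_eq_coeff K (exponents_single p.2)]
  rfl

variable {K}

/-- The coefficient of `M_{l'}` in `Φ(M_l)`. -/
def transition (Φ : QSymEnd K) (l l' : List ℕ) : K :=
  coefOfList K l' (Φ.toAlgHom (monomialOfList K l))

theorem monomialOfList_mem (l : List ℕ) : monomialOfList K l ∈ degreePart K l.sum := by
  rw [monomialOfList]
  split_ifs with h
  · exact M_mem_degreePart K _
  · exact zero_mem _

theorem transition_eq_zero (Φ : QSymEnd K) {l l' : List ℕ} (h : l.sum ≠ l'.sum) :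
    transition Φ l l' = 0 :=
  coefOfList_eq_zero_of_degree K (Φ.map_degree _ _ (monomialOfList_mem l)) (Ne.symm h)

/-- As `Φ` respects the coproduct, its matrix in the basis `(M_α)` is determined by the columns
that belong to compositions with one part. -/
theorem transition_append (Φ : QSymEnd K) {n : ℕ} (α : Composition n) (l l' : List ℕ) :
    transition Φ α.blocks (l ++ l') = ∑ j ∈ Finset.range (α.length + 1),
      transition Φ (α.blocks.take j) l * transition Φ (α.blocks.drop j) l' := by
  have h1 := congrArg (fun φ : QSym K →ₗ[K] QSym K ⊗[K] QSym K => φ (M K α)) Φ.map_comul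
  simp only [LinearMap.comp_apply, AlgHom.toLinearMap_apply] at h1
  rw [transition, monomialOfList_blocks, coefOfList_append, h1]
  change LinearMap.mul' K K (TensorProduct.map (coefOfList K l) (coefOfList K l')
    (TensorProduct.map _ _ (comul K (monomialBasis K ⟨n, α⟩)))) = _
  rw [comul, Module.Basis.constr_basis]
  simp only [map_sum, TensorProduct.map_tmul, LinearMap.mul'_apply, AlgHom.toLinearMap_apply,
    transition]
  refine Finset.sum_congr rfl fun j _ => ?_
  rw [← monomialOfList_blocks K (takeParts α j), ← monomialOfList_blocks K (dropParts α j)]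
  rfl

theorem map_M_eq_sum (Φ : QSymEnd K) {n : ℕ} (α : Composition n) :
    Φ.toAlgHom (M K α) =
      ∑ β : Composition n, transition Φ α.blocks β.blocks • M K β := by
  rw [eq_sum_coefOfList K (Φ.map_degree n _ (M_mem_degreePart K α))]
  simp only [transition, monomialOfList_blocks]

theorem pairing_universalCharacter {n : ℕ} {G : QSym K} (hG : G ∈ degreePart K n) :
    pairing (universalCharacter K) G = coefOfList K (onePart n).blocks G := by
  classical
  induction hG using Submodule.span_induction with
  | mem x hx =>
    obtain ⟨α, rfl⟩ := hx
    rw [pairing_M, coefOfList_M, universalCharacter, Module.Basis.repr_self, Finsupp.single_apply]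
    exact if_congr (by rw [Composition.ext_iff, eq_comm]) rfl rfl
  | zero => simp
  | add x y _ _ hx hy => rw [map_add, map_add, hx, hy]
  | smul a x _ hx => rw [map_smul, map_smul, hx]

theorem pairing_charSeries (Φ : QSymEnd K) {n : ℕ} (α : Composition n) :
    pairing (charSeries Φ) (M K α) = transition Φ α.blocks (onePart n).blocks := by
  rw [charSeries, pairing_twist, transition, monomialOfList_blocks]
  exact pairing_universalCharacter (Φ.map_degree n _ (M_mem_degreePart K α))

theorem lam_eq_transition (Φ : QSymEnd K) (m : ℕ) :
    lam Φ m = transition Φ (onePart m).blocks (onePart m).blocks :=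
  pairing_charSeries Φ _

theorem onePart_blocks {m : ℕ} (h : 0 < m) : (onePart m).blocks = [m] := by
  cases m with
  | zero => omega
  | succ m => rfl

theorem transition_nil (Φ : QSymEnd K) : transition Φ [] [] = 1 := by
  have h : (Composition.ones 0).blocks = [] := rfl
  have hM : M K (Composition.ones 0) = 1 := by
    apply Subtype.ext
    rw [coe_M]
    ext d
    rw [coeff_monomialSeries]
    change _ = MvPowerSeries.coeff d (1 : MvPowerSeries ℕ K)
    classical
    rw [MvPowerSeries.coeff_one, h]
    refine if_congr ⟨fun hd => ?_, ?_⟩ rfl rfl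
    · have := exponents_sum d
      rw [hd, List.sum_nil] at this
      exact (Finsupp.degree_eq_zero_iff d).mp this.symm
    · rintro rfl
      simp [exponents]
  rw [transition, ← h, monomialOfList_blocks, hM, map_one, ← hM, coefOfList_M, if_pos rfl]

/-- A sum over the ways of cutting a composition of `m + n` into two pieces, the first of which
has size `m`, is a sum over pairs of compositions. -/
theorem sum_cut_eq_sum_append {V : Type*} [AddCommMonoid V] (m n : ℕ)
    (A : List ℕ → List ℕ → V) (hA : ∀ l l', l.sum ≠ m → A l l' = 0) :
    ∑ α : Composition (m + n), ∑ j ∈ Finset.range (α.length + 1),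
      A (α.blocks.take j) (α.blocks.drop j) =
    ∑ α₁ : Composition m, ∑ α₂ : Composition n, A α₁.blocks α₂.blocks := by
  rw [Finset.sum_sigma', ← Finset.sum_product', Finset.univ_product_univ]
  symm
  refine Finset.sum_of_injOn (fun p : Composition m × Composition n =>
    (⟨p.1.append p.2, p.1.length⟩ : Σ _ : Composition (m + n), ℕ)) ?_ ?_ ?_ ?_
  · rintro ⟨α₁, α₂⟩ _ ⟨β₁, β₂⟩ _ h
    simp only [Sigma.mk.injEq, heq_eq_eq] at h
    have h1 : α₁.blocks ++ α₂.blocks = β₁.blocks ++ β₂.blocks :=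
      congrArg Composition.blocks h.1
    obtain ⟨h2, h3⟩ := List.append_inj h1 h.2
    exact Prod.ext (Composition.ext h2) (Composition.ext h3)
  · rintro ⟨α₁, α₂⟩ _
    simp [Composition.length, Composition.append]
  · rintro ⟨α, j⟩ hj hn
    simp only [Finset.mem_sigma, Finset.mem_univ, Finset.mem_range, true_and] at hj
    apply hA
    intro hm
    refine hn ⟨(⟨α.blocks.take j, fun h => α.blocks_pos (List.mem_of_mem_take h), hm⟩,
      ⟨α.blocks.drop j, fun h => α.blocks_pos (List.mem_of_mem_drop h), ?_⟩), by simp, ?_⟩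
    · have h1 := List.sum_take_add_sum_drop α.blocks j
      rw [hm, α.blocks_sum] at h1
      omega
    · have hl : (α.blocks.take j).length = j := by
        rw [List.length_take]
        exact min_eq_left (Nat.lt_succ_iff.mp hj)
      simp only [Sigma.mk.injEq, heq_eq_eq, Composition.length, hl, and_true]
      exact Composition.ext (List.take_append_drop j α.blocks)
  · rintro ⟨α₁, α₂⟩ _
    simp [Composition.append, Composition.length]

/-! ### Counting words with given content -/

/-- The content of a word `f` of length `m` in the letters `0, 1, …`: the exponent of the monomial
`∏ x_{f i}`. -/
def content {m : ℕ} (f : Fin m → ℕ) : ℕ →₀ ℕ := ∑ i, Finsupp.single (f i) 1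

theorem content_comp_perm {m : ℕ} (f : Fin m → ℕ) (τ : Equiv.Perm (Fin m)) :
    content (f ∘ τ) = content f :=
  Equiv.sum_comp τ fun i => Finsupp.single (f i) 1

theorem content_append {m n : ℕ} (h : Fin (m + n) → ℕ) :
    content h = content (h ∘ Fin.castAdd n) + content (h ∘ Fin.natAdd m) :=
  Fin.sum_univ_add _

theorem degree_content {m : ℕ} (f : Fin m → ℕ) : (content f).degree = m := by
  simp [content]

theorem content_apply {m : ℕ} (f : Fin m → ℕ) (w : ℕ) :
    content f w = (Finset.univ.filter fun k => f k = w).card := by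
  simp [content, Finsupp.finsetSum_apply, Finsupp.single_apply]

theorem sum_range_content {m : ℕ} (f : Fin m → ℕ) (v : ℕ) :
    ∑ w ∈ Finset.range v, content f w = (Finset.univ.filter fun k => f k < v).card := by
  rw [Finset.card_eq_sum_card_fiberwise (f := f) (t := Finset.range v)]
  · refine Finset.sum_congr rfl fun w hw => ?_
    rw [content_apply, Finset.filter_filter]
    congr 1
    ext k
    simp only [Finset.mem_filter, Finset.mem_univ, true_and]
    rw [Finset.mem_range] at hw
    omega
  · intro k hk
    simpa using hk

theorem lt_sum_range_content_iff {m : ℕ} {f : Fin m → ℕ} (hf : Monotone f) (k : Fin m) (v : ℕ) :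
    (k : ℕ) < ∑ w ∈ Finset.range v, content f w ↔ f k < v := by
  rw [sum_range_content]
  exact Tuple.lt_card_lt_iff_apply_lt_of_monotone hf

theorem eq_of_content_eq {m : ℕ} {f g : Fin m → ℕ} (hf : Monotone f) (hg : Monotone g)
    (h : content f = content g) : f = g := by
  have key : ∀ k v, f k < v ↔ g k < v := fun k v => by
    rw [← lt_sum_range_content_iff hf, ← lt_sum_range_content_iff hg, h]
  funext k
  have h1 := key k (f k + 1)
  have h2 := key k (g k + 1)
  omega

theorem exists_content_eq (d : ℕ →₀ ℕ) : ∃ f : Fin d.degree → ℕ, Monotone f ∧ content f = d := by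
  obtain ⟨l, hl⟩ : ∃ l : List ℕ, (l : Multiset ℕ) = Finsupp.toMultiset d :=
    ⟨_, Multiset.coe_toList _⟩
  have hlen : l.length = d.degree := by
    rw [← Multiset.coe_card, hl, Finsupp.card_toMultiset]
    rfl
  have hc : content l.get = d := by
    apply (Finsupp.orderIsoMultiset (ι := ℕ)).injective
    change Finsupp.toMultiset _ = Finsupp.toMultiset d
    rw [content, map_sum, ← hl]
    simp only [Finsupp.toMultiset_single, one_smul]
    change (Finset.univ.val.map fun i => ({l.get i} : Multiset ℕ)).sum = _
    rw [← Function.comp_def (fun a => ({a} : Multiset ℕ)) l.get, ← Multiset.map_map,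
      Multiset.sum_map_singleton, Fin.univ_val_map, List.ofFn_get]
  rw [← hlen]
  exact ⟨l.get ∘ Tuple.sort l.get, Tuple.monotone_sort _, (content_comp_perm _ _).trans hc⟩

theorem exists_filter_lt_eq_take {L : List ℕ} (hL : L.Pairwise (· < ·)) (v : ℕ) :
    ∃ j, L.filter (· < v) = L.take j := by
  induction L with
  | nil => exact ⟨0, rfl⟩
  | cons a t ih =>
    rw [List.pairwise_cons] at hL
    by_cases ha : a < v
    · obtain ⟨j, hj⟩ := ih hL.2
      exact ⟨j + 1, by simp [ha, hj]⟩
    · refine ⟨0, ?_⟩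
      rw [List.take_zero, List.filter_eq_nil_iff]
      intro b hb
      rcases List.mem_cons.mp hb with rfl | hb
      · simpa using ha
      · have := hL.1 b hb
        simp
        omega

theorem exists_take_eq_filter_lt {L : List ℕ} (hL : L.Pairwise (· < ·)) (j : ℕ) :
    ∃ v, L.take j = L.filter (· < v) := by
  induction L generalizing j with
  | nil => exact ⟨0, by simp⟩
  | cons a t ih =>
    rw [List.pairwise_cons] at hL
    cases j with
    | zero => exact ⟨0, by simp⟩
    | succ j =>
      obtain ⟨v, hv⟩ := ih hL.2 j
      refine ⟨max v (a + 1), ?_⟩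
      rw [List.take_succ_cons, hv, List.filter_cons_of_pos (by simp)]
      congr 1
      refine List.filter_congr fun b hb => ?_
      have := hL.1 b hb
      simp
      omega

/-- The sum of the first `j` nonzero exponents of `x^d` is the sum of all exponents below some
variable, and conversely. -/
theorem exists_sum_take_exponents_iff (d : ℕ →₀ ℕ) (s : ℕ) :
    (∃ j, ((exponents d).take j).sum = s) ↔ ∃ v, ∑ w ∈ Finset.range v, d w = s := by
  have hL : (d.support.sort (· ≤ ·)).Pairwise (· < ·) := Finset.sortedLT_sort _ |>.pairwise
  have hsum : ∀ v, (((d.support.sort (· ≤ ·)).filter (· < v)).map d).sum =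
      ∑ w ∈ Finset.range v, d w := by
    intro v
    rw [← List.sum_toFinset _ ((Finset.sort_nodup _ _).filter _)]
    refine Finset.sum_subset_zero_on_sdiff ?_ ?_ fun _ _ => rfl
    · intro w hw
      simp at hw ⊢
      exact hw.2
    · intro w hw
      simp at hw
      by_contra hne
      exact absurd hw.1 (not_lt.mpr (hw.2 hne))
  constructor
  · rintro ⟨j, rfl⟩
    obtain ⟨v, hv⟩ := exists_take_eq_filter_lt hL j
    exact ⟨v, by rw [exponents, ← List.map_take, hv, hsum]⟩
  · rintro ⟨v, rfl⟩
    obtain ⟨j, hj⟩ := exists_filter_lt_eq_take hL v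
    exact ⟨j, by rw [exponents, ← List.map_take, ← hj, hsum]⟩

/-- The partial sums of the exponents of a monomial are the places where the weakly increasing
word with that content increases. -/
theorem exists_sum_take_exponents_content_iff {m : ℕ} {f : Fin m → ℕ} (hf : Monotone f) {i : ℕ}
    (hi : i + 1 < m) : (∃ j, ((exponents (content f)).take j).sum = i + 1) ↔
      f ⟨i, by omega⟩ < f ⟨i + 1, hi⟩ := by
  rw [exists_sum_take_exponents_iff]
  have h1 := fun v => lt_sum_range_content_iff hf ⟨i, by omega⟩ v
  have h2 := fun v => lt_sum_range_content_iff hf ⟨i + 1, hi⟩ v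
  dsimp only at h1 h2
  constructor
  · rintro ⟨v, hv⟩
    have := h1 v
    have := h2 v
    omega
  · intro h
    refine ⟨f ⟨i + 1, hi⟩, ?_⟩
    have := h1 (f ⟨i + 1, hi⟩)
    have := h2 (f ⟨i + 1, hi⟩)
    omega

/-- The words of length `m` with content `d`. -/
def words (m : ℕ) (d : ℕ →₀ ℕ) : Finset (Fin m → ℕ) :=
  (Fintype.piFinset fun _ => d.support).filter fun f => content f = d

theorem mem_words {m : ℕ} {d : ℕ →₀ ℕ} {f : Fin m → ℕ} : f ∈ words m d ↔ content f = d := by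
  rw [words, Finset.mem_filter, and_iff_right_iff_imp]
  rintro rfl
  rw [Fintype.mem_piFinset]
  intro i
  rw [Finsupp.mem_support_iff, content_apply]
  exact (Finset.card_pos.mpr ⟨i, by simp⟩).ne'

open Classical in
/-- The number of words with content `d` and property `A`: the coefficient of `x^d` in
the sum of the monomials `∏ x_{f i}` over all words `f` with property `A`. -/
def count {m : ℕ} (A : (Fin m → ℕ) → Prop) (d : ℕ →₀ ℕ) : ℕ := ((words m d).filter A).card

/-- The coefficient form of the product of two generating functions of words: a word of length
`m + n` is cut into its first `m` and its last `n` letters. -/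
theorem sum_count_mul_count {m n : ℕ} (A : (Fin m → ℕ) → Prop) (B : (Fin n → ℕ) → Prop)
    (d : ℕ →₀ ℕ) :
    ∑ p ∈ Finset.HasAntidiagonal.antidiagonal d, count A p.1 * count B p.2 =
      count (fun h : Fin (m + n) → ℕ => A (h ∘ Fin.castAdd n) ∧ B (h ∘ Fin.natAdd m)) d := by
  classical
  symm
  rw [count, Finset.card_eq_sum_card_fiberwise
    (f := fun h => (content (h ∘ Fin.castAdd n), content (h ∘ Fin.natAdd m)))
    (t := Finset.HasAntidiagonal.antidiagonal d)]
  · refine Finset.sum_congr rfl fun p hp => ?_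
    rw [Finset.HasAntidiagonal.mem_antidiagonal] at hp
    rw [count, count, ← Finset.card_product]
    refine Finset.card_bij' (fun h _ => (h ∘ Fin.castAdd n, h ∘ Fin.natAdd m))
      (fun q _ => Fin.append q.1 q.2) ?_ ?_ ?_ ?_
    · intro h hh
      simp only [Finset.mem_filter, mem_words, Prod.ext_iff, Finset.mem_product] at hh ⊢
      tauto
    · rintro ⟨f, g⟩ hq
      have e1 : Fin.append f g ∘ Fin.castAdd n = f := by ext i; simp
      have e2 : Fin.append f g ∘ Fin.natAdd m = g := by ext i; simp
      simp only [Finset.mem_filter, mem_words, Prod.ext_iff, Finset.mem_product] at hq ⊢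
      rw [content_append, e1, e2]
      refine ⟨⟨?_, hq.1.2, hq.2.2⟩, hq.1.1, hq.2.1⟩
      rw [hq.1.1, hq.2.1, hp]
    · intro h _
      exact Fin.append_castAdd_natAdd
    · rintro ⟨f, g⟩ _
      ext i <;> simp
  · intro h hh
    simp only [Finset.coe_filter, Set.mem_ofPred_eq, mem_words] at hh
    rw [Finset.mem_coe, Finset.HasAntidiagonal.mem_antidiagonal, ← content_append, hh.1]

/-! ### Fundamental quasisymmetric functions -/

/-- The word `f` increases weakly, and strictly at the descents of `u`, at every place that does
not belong to `C`; put differently, `(f i, u i)` increases lexicographically there. -/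
def Compatible (u : ℕ → ℕ) (C : Set ℕ) {m : ℕ} (f : Fin m → ℕ) : Prop :=
  ∀ i (h : i + 1 < m), i + 1 ∉ C →
    f ⟨i, by omega⟩ < f ⟨i + 1, h⟩ ∨ f ⟨i, by omega⟩ = f ⟨i + 1, h⟩ ∧ u i ≤ u (i + 1)

/-- Every descent of `u 0, …, u (m - 1)` is a partial sum of `γ`. -/
def DescentsIn (u : ℕ → ℕ) {m : ℕ} (γ : Composition m) : Prop :=
  ∀ i, i + 1 < m → u (i + 1) < u i → i + 1 ∈ cuts γ

open Classical in
variable (K) in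
/-- The fundamental quasisymmetric function of degree `m` that belongs to the descents of
`u 0, …, u (m - 1)`. -/
def fundamental (u : ℕ → ℕ) (m : ℕ) : QSym K := ∑ γ : Composition m with DescentsIn u γ, M K γ

theorem fundamental_mem (u : ℕ → ℕ) (m : ℕ) : fundamental K u m ∈ degreePart K m :=
  Submodule.sum_mem _ fun γ _ => M_mem_degreePart K γ

theorem monotone_fin_of_le_succ {α : Type*} [Preorder α] {m : ℕ} {f : Fin m → α}
    (h : ∀ i (hi : i + 1 < m), f ⟨i, by omega⟩ ≤ f ⟨i + 1, hi⟩) : Monotone f := by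
  cases m with
  | zero => exact fun i => i.elim0
  | succ m => exact Fin.monotone_iff_le_succ.mpr fun i => h i (by omega)

theorem strictMono_fin_of_lt_succ {α : Type*} [Preorder α] {m : ℕ} {f : Fin m → α}
    (h : ∀ i (hi : i + 1 < m), f ⟨i, by omega⟩ < f ⟨i + 1, hi⟩) : StrictMono f := by
  cases m with
  | zero => exact fun i => i.elim0
  | succ m => exact Fin.strictMono_iff_lt_succ.mpr fun i => h i (by omega)

theorem compatible_empty_iff {u : ℕ → ℕ} {m : ℕ} {f : Fin m → ℕ} :
    Compatible u ∅ f ↔ Monotone f ∧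
      ∀ i (h : i + 1 < m), u (i + 1) < u i → f ⟨i, by omega⟩ < f ⟨i + 1, h⟩ := by
  constructor
  · intro h
    refine ⟨monotone_fin_of_le_succ fun i hi => ?_, fun i hi hu => ?_⟩
    · rcases h i hi (Set.notMem_empty _) with h | h
      · exact h.le
      · exact h.1.le
    · rcases h i hi (Set.notMem_empty _) with h | h
      · exact h
      · omega
  · rintro ⟨hf, h⟩ i hi -
    have h1 : f ⟨i, by omega⟩ ≤ f ⟨i + 1, hi⟩ := hf (Fin.mk_le_mk.mpr (Nat.le_succ i))
    have h2 := h i hi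
    omega

/-- The fundamental quasisymmetric function is the generating function of the compatible words. -/
theorem coeff_fundamental (u : ℕ → ℕ) (m : ℕ) (d : ℕ →₀ ℕ) :
    MvPowerSeries.coeff d (fundamental K u m : MvPowerSeries ℕ K) =
      (count (m := m) (Compatible u ∅) d : K) := by
  classical
  have h0 : MvPowerSeries.coeff d (fundamental K u m : MvPowerSeries ℕ K) =
      ∑ γ : Composition m with DescentsIn u γ, if exponents d = γ.blocks then 1 else 0 := by
    rw [fundamental, AddSubmonoidClass.coe_finsetSum, map_sum]
    exact Finset.sum_congr rfl fun γ _ => by rw [coe_M, coeff_monomialSeries]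
  rw [h0, Finset.sum_boole]
  congr 1
  rw [count]
  by_cases hd : d.degree = m
  · subst hd
    -- Both sides are `1` or `0`: the only candidates are the composition formed by the exponents
    -- of `x^d` and the weakly increasing word `f` with content `d`.
    obtain ⟨f, hf, hfd⟩ := exists_content_eq d
    have hγ : ∀ γ : Composition d.degree, exponents d = γ.blocks →
        (DescentsIn u γ ↔ Compatible u ∅ f) := by
      intro γ hγ
      rw [compatible_empty_iff, and_iff_right hf]
      refine forall_congr' fun i => forall_congr' fun hi => imp_congr_right fun _ => ?_
      rw [← exists_sum_take_exponents_content_iff hf hi, hfd, hγ, mem_cuts]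
      exact ⟨fun h => h.2.2, fun h => ⟨Nat.succ_pos i, hi, h⟩⟩
    by_cases hc : Compatible u ∅ f
    · have e1 : (words d.degree d).filter (Compatible u ∅) = {f} := by
        ext g
        rw [Finset.mem_filter, mem_words, Finset.mem_singleton]
        constructor
        · rintro ⟨h1, h2⟩
          exact eq_of_content_eq (compatible_empty_iff.mp h2).1 hf (h1.trans hfd.symm)
        · rintro rfl
          exact ⟨hfd, hc⟩
      rw [e1, Finset.card_singleton, Finset.card_eq_one]
      let c : Composition d.degree := ⟨exponents d, fun h => exponents_pos d h, exponents_sum d⟩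
      refine ⟨c, ?_⟩
      ext γ
      simp only [Finset.mem_filter, Finset.mem_univ, true_and, Finset.mem_singleton]
      constructor
      · exact fun h => Composition.ext h.2.symm
      · rintro rfl
        exact ⟨(hγ c rfl).mpr hc, rfl⟩
    · rw [Finset.card_eq_zero.mpr, Finset.card_eq_zero.mpr]
      · refine Finset.filter_eq_empty_iff.mpr fun g hg h => hc ?_
        rwa [← eq_of_content_eq (compatible_empty_iff.mp h).1 hf
          ((mem_words.mp hg).trans hfd.symm)]
      · refine Finset.filter_eq_empty_iff.mpr fun γ hg h => hc ?_
        exact (hγ γ h).mp (Finset.mem_filter.mp hg).2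
  · rw [Finset.card_eq_zero.mpr, Finset.card_eq_zero.mpr]
    · refine Finset.filter_eq_empty_iff.mpr fun g hg _ => hd ?_
      rw [← mem_words.mp hg, degree_content]
    · refine Finset.filter_eq_empty_iff.mpr fun γ _ h => hd ?_
      rw [← exponents_sum, h, γ.blocks_sum]

variable (K) in
/-- The product of the fundamental quasisymmetric functions of the consecutive factors, of lengths
`l = [b₁, b₂, …]`, of the word `u`. -/
def fundamentalProd : (ℕ → ℕ) → List ℕ → QSym K
  | _, [] => 1
  | u, b :: l => fundamental K u b * fundamentalProd (fun i => u (b + i)) l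

/-- The partial sums of a list. -/
def partialSums (l : List ℕ) : Set ℕ := {i | ∃ j, (l.take j).sum = i}

theorem mem_partialSums_cons {b i : ℕ} {l : List ℕ} :
    i ∈ partialSums (b :: l) ↔ i = 0 ∨ ∃ k ∈ partialSums l, i = b + k := by
  constructor
  · rintro ⟨j, rfl⟩
    cases j with
    | zero => exact Or.inl (by simp)
    | succ j => exact Or.inr ⟨_, ⟨j, rfl⟩, by simp⟩
  · rintro (rfl | ⟨k, ⟨j, rfl⟩, rfl⟩)
    · exact ⟨0, by simp⟩
    · exact ⟨j + 1, by simp⟩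

theorem zero_mem_partialSums (l : List ℕ) : 0 ∈ partialSums l := ⟨0, by simp⟩

theorem compatible_cons_iff (u : ℕ → ℕ) (b : ℕ) (l : List ℕ) {n : ℕ} (h : Fin (b + n) → ℕ) :
    Compatible u (partialSums (b :: l)) h ↔ Compatible u ∅ (h ∘ Fin.castAdd n) ∧
      Compatible (fun i => u (b + i)) (partialSums l) (h ∘ Fin.natAdd b) := by
  constructor
  · intro H
    refine ⟨fun i hi _ => H i (by omega) ?_, fun i hi hn => H (b + i) (by omega) ?_⟩
    · rw [mem_partialSums_cons]
      rintro (h | ⟨k, -, h⟩) <;> omega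
    · rw [mem_partialSums_cons]
      rintro (h | ⟨k, hk, h⟩)
      · omega
      · obtain rfl : k = i + 1 := by omega
        exact hn hk
  · rintro ⟨H1, H2⟩ i hi hn
    rw [mem_partialSums_cons] at hn
    push Not at hn
    rcases lt_trichotomy (i + 1) b with h' | h' | h'
    · exact H1 i h' (Set.notMem_empty _)
    · exact absurd h' (hn.2 0 (zero_mem_partialSums l))
    · obtain ⟨k, rfl⟩ : ∃ k, i = b + k := ⟨i - b, by omega⟩
      refine H2 k (by omega) fun hk => hn.2 _ hk (by omega)

theorem coeff_fundamentalProd (l : List ℕ) (u : ℕ → ℕ) (d : ℕ →₀ ℕ) :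
    MvPowerSeries.coeff d (fundamentalProd K u l : MvPowerSeries ℕ K) =
      (count (m := l.sum) (Compatible u (partialSums l)) d : K) := by
  classical
  induction l generalizing u d with
  | nil =>
    change MvPowerSeries.coeff d (1 : MvPowerSeries ℕ K) = _
    rw [MvPowerSeries.coeff_one]
    change _ = (count (m := 0) (Compatible u (partialSums [])) d : K)
    have hw : ∀ f : Fin 0 → ℕ, content f = 0 := fun f => Finset.sum_of_isEmpty _
    rw [count, Finset.filter_true_of_mem fun f _ i hi => absurd hi (Nat.not_lt_zero _)]
    by_cases hd : d = 0
    · subst hd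
      have h1 : words 0 0 = Finset.univ := by
        ext f
        exact iff_of_true (mem_words.mpr (hw f)) (Finset.mem_univ f)
      rw [h1, if_pos rfl]
      simp
    · rw [if_neg hd, Finset.card_eq_zero.mpr, Nat.cast_zero]
      refine Finset.eq_empty_of_forall_notMem fun f hf => hd ?_
      rw [← mem_words.mp hf, hw]
  | cons b l ih =>
    change MvPowerSeries.coeff d ((fundamental K u b : MvPowerSeries ℕ K) *
      (fundamentalProd K (fun i => u (b + i)) l : MvPowerSeries ℕ K)) = _
    rw [MvPowerSeries.coeff_mul]
    simp only [coeff_fundamental, ih]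
    change _ = (count (m := b + l.sum) (Compatible u (partialSums (b :: l))) d : K)
    have h := sum_count_mul_count (m := b) (n := l.sum) (Compatible u ∅)
      (Compatible (fun i => u (b + i)) (partialSums l)) d
    simp only [← compatible_cons_iff] at h
    rw [← h]
    push_cast
    rfl

/-! ### The shuffle product of fundamental quasisymmetric functions -/

/-- The word of a permutation of `[n]`, continued by zeros. -/
def word {n : ℕ} (σ : Equiv.Perm (Fin n)) (i : ℕ) : ℕ := if h : i < n then σ ⟨i, h⟩ else 0

theorem word_apply {n : ℕ} (σ : Equiv.Perm (Fin n)) {i : ℕ} (h : i < n) :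
    word σ i = σ ⟨i, h⟩ := dif_pos h

/-- The pairs `(f i, σ i)` in lexicographic order. -/
def lexKey {n : ℕ} (σ : Equiv.Perm (Fin n)) (f : Fin n → ℕ) (i : Fin n) : ℕ ×ₗ Fin n :=
  toLex (f i, σ i)

theorem lexKey_injective {n : ℕ} (σ : Equiv.Perm (Fin n)) (f : Fin n → ℕ) :
    Function.Injective (lexKey σ f) := fun _ _ h =>
  σ.injective (congrArg (fun p : ℕ ×ₗ Fin n => (ofLex p).2) h)

theorem compatible_word_iff {n : ℕ} (σ : Equiv.Perm (Fin n)) (C : Set ℕ) (f : Fin n → ℕ) :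
    Compatible (word σ) C f ↔ ∀ i (h : i + 1 < n), i + 1 ∉ C →
      lexKey σ f ⟨i, by omega⟩ < lexKey σ f ⟨i + 1, h⟩ := by
  refine forall_congr' fun i => forall_congr' fun hi => imp_congr_right fun _ => ?_
  rw [lexKey, lexKey, Prod.Lex.toLex_lt_toLex, word_apply σ hi, word_apply σ (by omega)]
  refine or_congr_right (and_congr_right fun _ => ?_)
  have hne : σ ⟨i, by omega⟩ ≠ σ ⟨i + 1, hi⟩ := fun h => by simpa using σ.injective h
  exact ⟨fun h => lt_of_le_of_ne h hne, fun h => h.le⟩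

theorem compatible_word_empty_iff {n : ℕ} (σ : Equiv.Perm (Fin n)) (f : Fin n → ℕ) :
    Compatible (word σ) ∅ f ↔ StrictMono (lexKey σ f) := by
  rw [compatible_word_iff]
  refine ⟨fun h => strictMono_fin_of_lt_succ fun i hi => h i hi (Set.notMem_empty _),
    fun h i hi _ => h (Fin.mk_lt_mk.mpr (Nat.lt_succ_self i))⟩

open Classical in
/-- Sorting the letters of a word `f` by `(f i, π i)` produces a permutation `τ` and a word that is
compatible with `π τ⁻¹`; `f` is compatible with `π` off `C` if and only if all descents of `τ`
belong to `C`. -/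
theorem sum_count_compatible {n : ℕ} (π : Equiv.Perm (Fin n)) (C : Set ℕ) (d : ℕ →₀ ℕ) :
    ∑ τ : Equiv.Perm (Fin n) with (descents τ : Set ℕ) ⊆ C,
      count (m := n) (Compatible (word (π * τ⁻¹)) ∅) d =
    count (m := n) (Compatible (word π) C) d := by
  have hsort : ∀ f : Fin n → ℕ, StrictMono (lexKey π f ∘ Tuple.sort (lexKey π f)) := fun f =>
    (Tuple.monotone_sort _).strictMono_of_injective
      ((lexKey_injective π f).comp (Tuple.sort _).injective)
  have hkey : ∀ (τ : Equiv.Perm (Fin n)) (f : Fin n → ℕ),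
      lexKey (π * τ⁻¹) (f ∘ (τ⁻¹ : Equiv.Perm (Fin n))) =
        lexKey π f ∘ (τ⁻¹ : Equiv.Perm (Fin n)) := fun τ f => rfl
  -- The permutation obtained by sorting is the only one for which the rearranged word is
  -- compatible.
  have huniq : ∀ (τ : Equiv.Perm (Fin n)) (f : Fin n → ℕ),
      StrictMono (lexKey π f ∘ (τ⁻¹ : Equiv.Perm (Fin n))) ↔ (Tuple.sort (lexKey π f))⁻¹ = τ := by
    intro τ f
    constructor
    · intro h
      rw [inv_eq_iff_eq_inv, eq_comm, Tuple.eq_sort_iff]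
      exact ⟨h.monotone, fun i j hij he => absurd he (h hij).ne⟩
    · rintro rfl
      rw [inv_inv]
      exact hsort f
  have hdesc : ∀ (τ : Equiv.Perm (Fin n)) (f : Fin n → ℕ),
      (Tuple.sort (lexKey π f))⁻¹ = τ →
        ((descents τ : Set ℕ) ⊆ C ↔ Compatible (word π) C f) := by
    intro τ f h
    have hs := (huniq τ f).mpr h
    have hlt : ∀ i j, lexKey π f i < lexKey π f j ↔ τ i < τ j := by
      intro i j
      rw [← hs.lt_iff_lt]
      simp
    rw [compatible_word_iff]
    simp only [hlt]
    constructor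
    · intro H i hi hn
      refine lt_of_le_of_ne (not_lt.mp fun hlt' => hn (H ?_)) ?_
      · rw [Finset.mem_coe, descents, Finset.mem_filter]
        exact ⟨Finset.mem_range.mpr hi, Nat.succ_pos i, hi, hlt'⟩
      · rw [Ne, τ.injective.eq_iff, Fin.mk.injEq]
        omega
    · intro H i hi
      rw [Finset.mem_coe, descents, Finset.mem_filter] at hi
      obtain ⟨-, h0, hi, hlt'⟩ := hi
      obtain ⟨k, rfl⟩ : ∃ k, i = k + 1 := ⟨i - 1, by omega⟩
      by_contra hn
      exact (H k hi hn).asymm hlt'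
  -- Group the words `f` on the right by their sorting permutation `τ`; `f ↦ f ∘ τ⁻¹` maps each group
  -- onto the words counted on the left.
  symm
  rw [count, Finset.card_eq_sum_card_fiberwise (f := fun f => (Tuple.sort (lexKey π f))⁻¹)
    (t := Finset.univ.filter fun τ : Equiv.Perm (Fin n) => (descents τ : Set ℕ) ⊆ C)]
  · refine Finset.sum_congr rfl fun τ hτ => ?_
    rw [count]
    refine Finset.card_bij' (fun f _ => f ∘ (τ⁻¹ : Equiv.Perm (Fin n))) (fun g _ => g ∘ τ)
      ?_ ?_ ?_ ?_
    · intro f hf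
      simp only [Finset.mem_filter, mem_words] at hf ⊢
      rw [content_comp_perm, compatible_word_empty_iff, hkey, huniq]
      exact ⟨hf.1.1, hf.2⟩
    · intro g hg
      simp only [Finset.mem_filter, mem_words] at hg ⊢
      have hg' : (g ∘ τ) ∘ (τ⁻¹ : Equiv.Perm (Fin n)) = g := by
        ext i
        simp
      have h1 : (Tuple.sort (lexKey π (g ∘ τ)))⁻¹ = τ := by
        rw [← huniq, ← hkey, hg', ← compatible_word_empty_iff]
        exact hg.2
      refine ⟨⟨(content_comp_perm g τ).trans hg.1, (hdesc τ _ h1).mp ?_⟩, h1⟩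
      exact (Finset.mem_filter.mp hτ).2
    · intro f _
      ext i
      simp
    · intro g _
      ext i
      simp
  · intro f hf
    rw [Finset.mem_coe, Finset.mem_filter] at hf ⊢
    exact ⟨Finset.mem_univ _, (hdesc _ f rfl).mpr hf.2⟩

/-! ### Left multiplication by the character -/

theorem mem_partialSums_append {i : ℕ} {l l' : List ℕ} :
    i ∈ partialSums (l ++ l') ↔ i ∈ partialSums l ∨ ∃ k ∈ partialSums l', i = l.sum + k := by
  induction l generalizing i with
  | nil =>
    simp only [List.nil_append, List.sum_nil, zero_add, exists_eq_right']
    refine ⟨Or.inr, ?_⟩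
    rintro (⟨j, hj⟩ | h)
    · rw [← hj]
      simpa using zero_mem_partialSums l'
    · exact h
  | cons b l ih =>
    rw [List.cons_append, mem_partialSums_cons, mem_partialSums_cons, List.sum_cons]
    simp only [ih]
    constructor
    · rintro (h | ⟨k, hk | ⟨k', hk', rfl⟩, rfl⟩)
      · exact Or.inl (Or.inl h)
      · exact Or.inl (Or.inr ⟨k, hk, rfl⟩)
      · exact Or.inr ⟨k', hk', by omega⟩
    · rintro ((h | ⟨k, hk, rfl⟩) | ⟨k, hk, rfl⟩)
      · exact Or.inl h
      · exact Or.inr ⟨k, Or.inl hk, rfl⟩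
      · exact Or.inr ⟨l.sum + k, Or.inr ⟨k, hk, rfl⟩, by omega⟩

theorem le_sum_of_mem_partialSums {i : ℕ} {l : List ℕ} (h : i ∈ partialSums l) : i ≤ l.sum := by
  obtain ⟨j, rfl⟩ := h
  have := List.sum_take_add_sum_drop l j
  omega

theorem mem_cuts_iff_partialSums {n : ℕ} (α : Composition n) (i : ℕ) :
    i ∈ cuts α ↔ 0 < i ∧ i < n ∧ i ∈ partialSums α.blocks :=
  mem_cuts α i

theorem descentsIn_iff {u : ℕ → ℕ} {n : ℕ} {α : Composition n} : DescentsIn u α ↔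
    ∀ i, i + 1 < n → u (i + 1) < u i → i + 1 ∈ partialSums α.blocks := by
  refine forall_congr' fun i => forall_congr' fun hi => imp_congr_right fun _ => ?_
  rw [mem_cuts_iff_partialSums]
  exact ⟨fun h => h.2.2, fun h => ⟨i.succ_pos, hi, h⟩⟩

theorem descentsIn_append_iff {u : ℕ → ℕ} {m n : ℕ} {α : Composition m} {β : Composition n} :
    DescentsIn u (α.append β) ↔ DescentsIn u α ∧ DescentsIn (fun i => u (m + i)) β := by
  simp only [descentsIn_iff, Composition.append, mem_partialSums_append, α.blocks_sum]
  constructor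
  · intro H
    refine ⟨fun i hi hu => ?_, fun i hi hu => ?_⟩
    · rcases H i (by omega) hu with h | ⟨k, _, h⟩
      · exact h
      · omega
    · rcases H (m + i) (by omega) hu with h | ⟨k, hk, h⟩
      · have := le_sum_of_mem_partialSums h
        rw [α.blocks_sum] at this
        omega
      · obtain rfl : k = i + 1 := by omega
        exact hk
  · rintro ⟨H1, H2⟩ i hi hu
    rcases lt_trichotomy (i + 1) m with h | h | h
    · exact Or.inl (H1 i h hu)
    · exact Or.inr ⟨0, zero_mem_partialSums _, by omega⟩
    · obtain ⟨k, rfl⟩ : ∃ k, i = m + k := ⟨i - m, by omega⟩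
      exact Or.inr ⟨k + 1, H2 k (by omega) hu, by omega⟩

open Classical in
theorem coef_map_fundamental (Φ : QSymEnd K) (u : ℕ → ℕ) (n : ℕ) (l : List ℕ) :
    coefOfList K l (Φ.toAlgHom (fundamental K u n)) =
      ∑ α : Composition n with DescentsIn u α, transition Φ α.blocks l := by
  rw [fundamental, map_sum, map_sum]
  exact Finset.sum_congr rfl fun α _ => by rw [transition, monomialOfList_blocks]

/-- Since `Δ(F_u) = ∑ F_{u'} ⊗ F_{u''}` over the factorizations `u = u' u''`, the coefficient of
`M_{l·l'}` in `Φ(F_u)` is a product of two coefficients. -/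
theorem coef_append_map_fundamental (Φ : QSymEnd K) (u : ℕ → ℕ) {m : ℕ} (n : ℕ)
    (l l' : List ℕ) (hl : l.sum = m) :
    coefOfList K (l ++ l') (Φ.toAlgHom (fundamental K u (m + n))) =
      coefOfList K l (Φ.toAlgHom (fundamental K u m)) *
        coefOfList K l' (Φ.toAlgHom (fundamental K (fun i => u (m + i)) n)) := by
  classical
  simp only [coef_map_fundamental, Finset.sum_mul_sum]
  have h := sum_cut_eq_sum_append (V := K) m n
    (fun l₁ l₂ => if ∀ i, i + 1 < m + n → u (i + 1) < u i → i + 1 ∈ partialSums (l₁ ++ l₂)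
      then transition Φ l₁ l * transition Φ l₂ l' else 0) (by
      intro l₁ l₂ hne
      rw [transition_eq_zero Φ (by rwa [hl]), zero_mul, ite_self])
  simp only [List.take_append_drop] at h
  simp only [Finset.sum_filter]
  rw [← Finset.sum_congr rfl fun α _ => ?_, h]
  · refine Finset.sum_congr rfl fun α₁ _ => ?_
    rw [Finset.ite_sum_zero]
    refine Finset.sum_congr rfl fun α₂ _ => ?_
    rw [← ite_and]
    exact if_congr (descentsIn_iff.symm.trans
      (descentsIn_append_iff (α := α₁) (β := α₂))) rfl rfl
  · rw [transition_append, ← Finset.ite_sum_zero]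
    exact if_congr descentsIn_iff.symm rfl rfl

theorem fundamental_zero (u : ℕ → ℕ) : fundamental K u 0 = 1 := by
  apply Subtype.ext
  ext d
  rw [coeff_fundamental]
  refine Eq.trans ?_ (coeff_fundamentalProd [] u d).symm
  change _ = (count (m := 0) (Compatible u (partialSums [])) d : K)
  congr 2
  funext f
  exact propext (iff_of_true (fun i hi => absurd hi (Nat.not_lt_zero _))
    (fun i hi => absurd hi (Nat.not_lt_zero _)))

/-- The coefficient of `M_l` in the image of a fundamental quasisymmetric function. The
coproduct splits the word into factors of lengths `l`, and the multiplicativity of `Φ` collects the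
values at the factors into the value at a product. -/
theorem coef_map_fundamental_eq (Φ : QSymEnd K) (l : List ℕ) (hl : ∀ a ∈ l, 0 < a)
    (u : ℕ → ℕ) : coefOfList K l (Φ.toAlgHom (fundamental K u l.sum)) =
      coefOfList K (onePart l.sum).blocks (Φ.toAlgHom (fundamentalProd K u l)) := by
  induction l generalizing u with
  | nil =>
    rw [List.sum_nil, fundamental_zero]
    rfl
  | cons b l ih =>
    have hb := onePart_blocks (hl b List.mem_cons_self)
    have h1 := coef_append_map_fundamental Φ u (m := b) l.sum [b] l (by simp)
    rw [List.singleton_append] at h1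
    rw [List.sum_cons, h1, ih (fun a ha => hl a (List.mem_cons_of_mem _ ha)), fundamentalProd,
      map_mul, coefOfList_onePart_mul, Finset.sum_eq_single (b, l.sum), hb]
    -- As `F_u` is homogeneous of degree `b`, only the pair `(b, l.sum)` of degrees contributes.
    · rintro ⟨i, j⟩ hij hne
      rw [coefOfList_eq_zero_of_degree K (Φ.map_degree _ _ (fundamental_mem u b)), zero_mul]
      rw [Composition.blocks_sum]
      rintro rfl
      rw [Finset.HasAntidiagonal.mem_antidiagonal] at hij
      exact hne (Prod.ext rfl (by dsimp only at hij ⊢; omega))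
    · intro h
      exact absurd (by rw [Finset.HasAntidiagonal.mem_antidiagonal]) h

theorem descents_subset_cuts_iff {n : ℕ} (σ : Equiv.Perm (Fin n)) (α : Composition n) :
    descents σ ⊆ cuts α ↔ DescentsIn (word σ) α := by
  constructor
  · intro H i hi hu
    rw [word_apply σ hi, word_apply σ (by omega)] at hu
    exact H (Finset.mem_filter.mpr ⟨Finset.mem_range.mpr hi, i.succ_pos, hi, hu⟩)
  · intro H i hi
    obtain ⟨-, h0, hi, hu⟩ := Finset.mem_filter.mp hi
    obtain ⟨k, rfl⟩ : ∃ k, i = k + 1 := ⟨i - 1, by omega⟩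
    refine H k hi ?_
    rw [word_apply σ hi, word_apply σ (by omega)]
    exact hu

theorem descents_coe_subset_partialSums_iff {n : ℕ} (σ : Equiv.Perm (Fin n)) (α : Composition n) :
    (descents σ : Set ℕ) ⊆ partialSums α.blocks ↔ descents σ ⊆ cuts α := by
  refine forall_congr' fun i => imp_congr_right fun hi => ?_
  obtain ⟨-, h0, hi, -⟩ := Finset.mem_filter.mp (Finset.mem_coe.mp hi)
  rw [mem_cuts_iff_partialSums]
  exact ⟨fun h => ⟨h0, hi, h⟩, fun h => h.2.2⟩

open Classical in
theorem coeff_sum_smul_xSum {n : ℕ} (g : Composition n → K) (σ : Equiv.Perm (Fin n)) :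
    (∑ α, g α • xSum K α).coeff σ = ∑ α with DescentsIn (word σ) α, g α := by
  rw [Finset.sum_filter, MonoidAlgebra.coeff_sum, Finsupp.finsetSum_apply]
  refine Finset.sum_congr rfl fun α _ => ?_
  rw [MonoidAlgebra.coeff_smul_apply]
  simp [xSum, Finsupp.single_apply, MonoidAlgebra.of_apply, descents_subset_cuts_iff]

theorem coe_charSeries (Φ : QSymEnd K) (n : ℕ) :
    (charSeries Φ n : MonoidAlgebra K (Equiv.Perm (Fin n))) =
      ∑ α : Composition n, transition Φ α.blocks (onePart n).blocks • xSum K α := by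
  conv_lhs => rw [← (xBasis K n).sum_repr (charSeries Φ n)]
  rw [AddSubmonoidClass.coe_finsetSum]
  refine Finset.sum_congr rfl fun α _ => ?_
  rw [Submodule.coe_smul, coe_xBasis, ← pairing_M, pairing_charSeries]

/-- The coefficients of the character in the group algebra are its values at the fundamental
quasisymmetric functions. -/
theorem coeff_charSeries (Φ : QSymEnd K) {n : ℕ} (σ : Equiv.Perm (Fin n)) :
    (charSeries Φ n : MonoidAlgebra K (Equiv.Perm (Fin n))).coeff σ =
      coefOfList K (onePart n).blocks (Φ.toAlgHom (fundamental K (word σ) n)) := by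
  classical
  rw [coe_charSeries, coeff_sum_smul_xSum, coef_map_fundamental]

theorem count_compatible_congr {m n : ℕ} (h : m = n) (u : ℕ → ℕ) (C : Set ℕ) (d : ℕ →₀ ℕ) :
    count (m := m) (Compatible u C) d = count (m := n) (Compatible u C) d := by
  subst h
  rfl

open Classical in
/-- The product of the fundamental quasisymmetric functions of the factors of a permutation is
the sum of those of their shuffles. -/
theorem sum_fundamental_eq_fundamentalProd {n : ℕ} (π : Equiv.Perm (Fin n)) (β : Composition n) :
    ∑ τ : Equiv.Perm (Fin n) with descents τ ⊆ cuts β, fundamental K (word (π * τ⁻¹)) n =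
      fundamentalProd K (word π) β.blocks := by
  apply Subtype.ext
  ext d
  rw [AddSubmonoidClass.coe_finsetSum, map_sum, coeff_fundamentalProd,
    count_compatible_congr β.blocks_sum, ← sum_count_compatible]
  simp only [coeff_fundamental, descents_coe_subset_partialSums_iff]
  push_cast
  rfl

/-- Left multiplication by `(X^Φ)_n` is the transpose of `Φ_n`. -/
theorem charSeries_mul_xSum (Φ : QSymEnd K) {n : ℕ} (β : Composition n) :
    (charSeries Φ n : MonoidAlgebra K (Equiv.Perm (Fin n))) * xSum K β =
      ∑ α : Composition n, transition Φ α.blocks β.blocks • xSum K α := by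
  classical
  ext π
  have h := coef_map_fundamental_eq Φ β.blocks (fun a ha => β.blocks_pos ha) (word π)
  rw [β.blocks_sum, ← sum_fundamental_eq_fundamentalProd, map_sum, map_sum,
    coef_map_fundamental] at h
  rw [coeff_sum_smul_xSum, h, xSum, Finset.mul_sum, MonoidAlgebra.coeff_sum,
    Finsupp.finsetSum_apply]
  refine Finset.sum_congr (by ext; simp) fun τ _ => ?_
  rw [← coeff_charSeries, MonoidAlgebra.of_apply]
  simp

theorem charSeries_mul_mem (Φ : QSymEnd K) (n : ℕ) :
    ∀ v ∈ descentAlgebra K n,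
      (charSeries Φ n : MonoidAlgebra K (Equiv.Perm (Fin n))) * v ∈ descentAlgebra K n := by
  intro v hv
  induction hv using Submodule.span_induction with
  | mem x hx =>
    obtain ⟨β, rfl⟩ := hx
    dsimp only
    rw [charSeries_mul_xSum]
    exact Submodule.sum_mem _ fun α _ =>
      Submodule.smul_mem _ _ (Submodule.subset_span ⟨α, rfl⟩)
  | zero => simp
  | add x y _ _ hx hy => rw [mul_add]; exact add_mem hx hy
  | smul a x _ hx => rw [mul_smul_comm]; exact Submodule.smul_mem _ _ hx

/-- Left multiplication by `(X^Φ)_n` as an operator on `𝒟_n`. -/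
def charMul (Φ : QSymEnd K) (n : ℕ) : Module.End K (descentAlgebra K n) :=
  leftMul (charSeries Φ n).1 (charSeries_mul_mem Φ n)

theorem charMul_xBasis (Φ : QSymEnd K) {n : ℕ} (β : Composition n) :
    charMul Φ n (xBasis K n β) =
      ∑ α : Composition n, transition Φ α.blocks β.blocks • xBasis K n α := by
  apply Subtype.ext
  change (charSeries Φ n).1 * (xBasis K n β).1 = _
  rw [coe_xBasis, charSeries_mul_xSum, AddSubmonoidClass.coe_finsetSum]
  simp only [Submodule.coe_smul, coe_xBasis]

/-! ### Spectral lemmas -/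

/-- Suppose that an operator has as many independent eigenvectors for nonzero eigenvalues as its
rank. They span the range, which is then a complement of the kernel, so the operator is
diagonalizable and has no eigenvectors for nonzero eigenvalues outside their span. -/
theorem isDiagonalizable_of_finrank_range {V ι : Type*} [AddCommGroup V] [Module K V]
    [FiniteDimensional K V] [Fintype ι] (T : Module.End K V) (z : ι → V) (c : ι → K)
    (hz : LinearIndependent K z) (hc : ∀ i, c i ≠ 0) (hT : ∀ i, T (z i) = c i • z i)
    (hr : Module.finrank K (LinearMap.range T) = Fintype.card ι) :
    IsDiagonalizable T ∧ ∀ μ : K, μ ≠ 0 →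
      Module.End.eigenspace T μ ≤ Submodule.span K {v | ∃ i, c i = μ ∧ v = z i} := by
  have hspan : Submodule.span K (Set.range z) = LinearMap.range T := by
    refine Submodule.eq_of_le_of_finrank_eq ?_ ?_
    · rw [Submodule.span_le]
      rintro _ ⟨i, rfl⟩
      exact ⟨(c i)⁻¹ • z i, by rw [map_smul, hT, inv_smul_smul₀ (hc i)]⟩
    · rw [finrank_span_eq_card hz, hr]
  have hexp : ∀ v, v ∈ LinearMap.range T → ∃ a : ι → K, ∑ i, a i • z i = v := by
    intro v hv
    rw [← hspan] at hv
    exact (Submodule.mem_span_range_iff_exists_fun K).mp hv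
  constructor
  · rw [IsDiagonalizable, eq_top_iff]
    intro v _
    obtain ⟨a, ha⟩ := hexp (T v) ⟨v, rfl⟩
    have h1 : ∑ i, (a i * (c i)⁻¹) • z i ∈ ⨆ μ : K, Module.End.eigenspace T μ := by
      refine Submodule.sum_mem _ fun i _ => Submodule.smul_mem _ _ ?_
      exact Submodule.mem_iSup_of_mem (c i) (Module.End.mem_eigenspace_iff.mpr (hT i))
    have h2 : v - ∑ i, (a i * (c i)⁻¹) • z i ∈ ⨆ μ : K, Module.End.eigenspace T μ := by
      refine Submodule.mem_iSup_of_mem 0 (Module.End.mem_eigenspace_iff.mpr ?_)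
      rw [map_sub, map_sum, zero_smul, sub_eq_zero, ← ha]
      refine Finset.sum_congr rfl fun i _ => ?_
      rw [map_smul, hT, smul_smul, inv_mul_cancel_right₀ (hc i)]
    simpa using add_mem h2 h1
  · intro μ hμ v hv
    rw [Module.End.mem_eigenspace_iff] at hv
    obtain ⟨a, rfl⟩ := hexp v ⟨μ⁻¹ • v, by rw [map_smul, hv, inv_smul_smul₀ hμ]⟩
    have h0 : ∑ i, (a i * (c i - μ)) • z i = 0 := by
      rw [← sub_eq_zero, map_sum, Finset.smul_sum, ← Finset.sum_sub_distrib] at hv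
      rw [← hv]
      refine Finset.sum_congr rfl fun i _ => ?_
      rw [map_smul, hT, smul_smul, smul_smul, ← sub_smul]
      congr 1
      ring
    refine Submodule.sum_mem _ fun i _ => ?_
    rcases mul_eq_zero.mp (Fintype.linearIndependent_iff.mp hz _ h0 i) with h | h
    · rw [h, zero_smul]
      exact zero_mem _
    · exact Submodule.smul_mem _ _ (Submodule.subset_span ⟨i, sub_eq_zero.mp h, rfl⟩)

/-- The transpose of a diagonalizable operator is diagonalizable: the basis dual to an eigenbasis
is an eigenbasis. -/
theorem IsDiagonalizable.of_dualMap {V W : Type*} [AddCommGroup V] [Module K V]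
    [AddCommGroup W] [Module K W] [FiniteDimensional K W] {T : Module.End K W}
    (hT : IsDiagonalizable T) (A : Module.End K V) (φ : V ≃ₗ[K] Module.Dual K W)
    (h : ∀ v, φ (A v) = T.dualMap (φ v)) : IsDiagonalizable A := by
  classical
  have hint : DirectSum.IsInternal (Module.End.eigenspace T) :=
    DirectSum.isInternal_submodule_of_iSupIndep_of_iSup_eq_top
      (Module.End.eigenspaces_iSupIndep T) hT
  let e := hint.collectedBasis fun μ => Module.finBasis K (Module.End.eigenspace T μ)
  have he : ∀ i, T (e i) = i.1 • e i := fun i =>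
    Module.End.mem_eigenspace_iff.mp (hint.collectedBasis_mem _ i)
  have := Module.Finite.finite_basis e
  have := Fintype.ofFinite (Σ μ : K, Fin (Module.finrank K (Module.End.eigenspace T μ)))
  have hcoord : ∀ i, T.dualMap (e.coord i) = i.1 • e.coord i := by
    intro i
    refine e.ext fun j => ?_
    rw [LinearMap.dualMap_apply, he, map_smul, LinearMap.smul_apply, Module.Basis.coord_apply,
      Module.Basis.repr_self]
    by_cases hij : j = i
    · rw [hij]
    · rw [Finsupp.single_eq_of_ne (Ne.symm hij), smul_zero, smul_zero]
  rw [IsDiagonalizable, eq_top_iff]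
  intro v _
  have hv : v = ∑ i, φ v (e i) • φ.symm (e.coord i) := by
    apply φ.injective
    rw [map_sum]
    refine e.ext fun j => ?_
    simp
  rw [hv]
  refine Submodule.sum_mem _ fun i _ => Submodule.smul_mem _ _ ?_
  refine Submodule.mem_iSup_of_mem i.1 (Module.End.mem_eigenspace_iff.mpr (φ.injective ?_))
  rw [h, map_smul, LinearEquiv.apply_symm_apply, hcoord]

/-! ### The duality between `𝒬_n` and `𝒟_n` -/

theorem linearIndependent_M (n : ℕ) : LinearIndependent K (fun α : Composition n => M K α) :=
  (monomialBasis K).linearIndependent.comp (fun α : Composition n => ⟨n, α⟩) fun _ _ h =>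
    eq_of_heq (Sigma.mk.inj h).2

variable (K) in
/-- The basis `(M_α)` of `𝒬_n`. -/
def degreeBasis (n : ℕ) : Module.Basis (Composition n) K (degreePart K n) :=
  Module.Basis.span (linearIndependent_M n)

theorem coe_degreeBasis {n : ℕ} (α : Composition n) : (degreeBasis K n α : QSym K) = M K α :=
  congrArg Subtype.val (Module.Basis.span_apply (linearIndependent_M (K := K) n) α)

theorem degreeMap_degreeBasis (Φ : QSymEnd K) {n : ℕ} (α : Composition n) :
    Φ.degreeMap n (degreeBasis K n α) =
      ∑ β : Composition n, transition Φ α.blocks β.blocks • degreeBasis K n β := by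
  apply Subtype.ext
  change Φ.toAlgHom (degreeBasis K n α : QSym K) = _
  rw [coe_degreeBasis, map_M_eq_sum, AddSubmonoidClass.coe_finsetSum]
  simp only [Submodule.coe_smul, coe_degreeBasis]

variable (K) in
/-- The identification of `𝒬_n` with the dual of `𝒟_n` by the pairing. -/
def degreePartEquivDual (n : ℕ) : degreePart K n ≃ₗ[K] Module.Dual K (descentAlgebra K n) :=
  (degreeBasis K n).equiv (xBasis K n).dualBasis (Equiv.refl _)

theorem degreePartEquivDual_degreeMap (Φ : QSymEnd K) (n : ℕ) (v : degreePart K n) :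
    degreePartEquivDual K n (Φ.degreeMap n v) =
      (charMul Φ n).dualMap (degreePartEquivDual K n v) := by
  have key : (degreePartEquivDual K n).toLinearMap ∘ₗ Φ.degreeMap n =
      (charMul Φ n).dualMap ∘ₗ (degreePartEquivDual K n).toLinearMap := by
    refine (degreeBasis K n).ext fun α => (xBasis K n).ext fun β => ?_
    simp only [LinearMap.comp_apply, LinearEquiv.coe_coe, degreeMap_degreeBasis, map_sum, map_smul,
      LinearMap.dualMap_apply, charMul_xBasis]
    simp [degreePartEquivDual, Finsupp.single_apply]
  exact congrArg (fun f : degreePart K n →ₗ[K] Module.Dual K (descentAlgebra K n) => f v) key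

theorem finrank_range_charMul (Φ : QSymEnd K) (n : ℕ) :
    Module.finrank K (LinearMap.range (charMul Φ n)) =
      Module.finrank K (LinearMap.range (Φ.degreeMap n)) := by
  have := Module.Basis.finiteDimensional_of_finite (xBasis K n)
  have key : (degreePartEquivDual K n).toLinearMap ∘ₗ Φ.degreeMap n =
      (charMul Φ n).dualMap ∘ₗ (degreePartEquivDual K n).toLinearMap :=
    LinearMap.ext (degreePartEquivDual_degreeMap Φ n)
  rw [← LinearMap.finrank_range_dualMap_eq_finrank_range,
    ← LinearMap.range_comp_of_range_eq_top (charMul Φ n).dualMap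
      (degreePartEquivDual K n).range, ← key, LinearMap.range_comp]
  exact LinearEquiv.finrank_map_eq (degreePartEquivDual K n) _

/-! ### The product `⋆` -/

variable (K) in
/-- The basis element `X_l` of `𝒟`, for a list `l` of positive integers; the value is zero if `l`
has a zero entry. -/
def xOfList (l : List ℕ) : DescentSum K :=
  if h : ∀ a ∈ l, 0 < a then
    DFinsupp.single l.sum (xBasis K l.sum ⟨l, fun ha => h _ ha, rfl⟩)
  else 0

theorem xOfList_blocks {n : ℕ} (α : Composition n) :
    xOfList K α.blocks = DFinsupp.single n (xBasis K n α) := by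
  rw [xOfList, dif_pos fun a ha => α.blocks_pos ha]
  have h : (⟨α.blocks.sum, ⟨α.blocks, fun ha => α.blocks_pos ha, rfl⟩⟩ : Σ n, Composition n) =
      ⟨n, α⟩ := sigma_composition_ext rfl
  exact congrArg (fun c : Σ n, Composition n =>
    (DFinsupp.single c.1 (xBasis K c.1 c.2) : DescentSum K)) h

theorem basis_descentSum (c : Σ n, Composition n) :
    DFinsupp.basis (xBasis K) c = (DFinsupp.single c.1 (xBasis K c.1 c.2) : DescentSum K) := by
  rw [Module.Basis.apply_eq_iff]
  change (sigmaFinsuppLequivDFinsupp K).symm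
    (DFinsupp.mapRange.linearEquiv (fun n => (xBasis K n).repr) (DFinsupp.single _ _)) = _
  rw [LinearEquiv.symm_apply_eq]
  refine Eq.trans ?_ (sigmaFinsuppEquivDFinsupp_single c 1).symm
  refine (DFinsupp.mapRange_single (hf := fun n => map_zero (xBasis K n).repr)).trans ?_
  rw [Module.Basis.repr_self]

theorem starMul_single {m n : ℕ} (α : Composition m) (β : Composition n) :
    starMul K (DFinsupp.single m (xBasis K m α)) (DFinsupp.single n (xBasis K n β)) =
      DFinsupp.single (m + n) (xBasis K (m + n) (α.append β)) := by
  have h1 := basis_descentSum (K := K) ⟨m, α⟩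
  have h2 := basis_descentSum (K := K) ⟨n, β⟩
  dsimp only at h1 h2
  rw [← h1, ← h2, starMul, Module.Basis.constr_basis, Module.Basis.constr_basis]

theorem starMul_xOfList {l l' : List ℕ} (h : ∀ a ∈ l, 0 < a) (h' : ∀ a ∈ l', 0 < a) :
    starMul K (xOfList K l) (xOfList K l') = xOfList K (l ++ l') := by
  have h1 := xOfList_blocks (K := K) (⟨l, fun ha => h _ ha, rfl⟩ : Composition l.sum)
  have h2 := xOfList_blocks (K := K) (⟨l', fun ha => h' _ ha, rfl⟩ : Composition l'.sum)
  dsimp only at h1 h2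
  rw [h1, h2, starMul_single, ← xOfList_blocks]
  rfl

/-- Left multiplication by `X^Φ` on `𝒟`, degree by degree. -/
def charMulSum (Φ : QSymEnd K) : DescentSum K →ₗ[K] DescentSum K :=
  DFinsupp.mapRange.linearMap (charMul Φ)

theorem charMulSum_single (Φ : QSymEnd K) (n : ℕ) (v : descentAlgebra K n) :
    charMulSum Φ (DFinsupp.single n v) = DFinsupp.single n (charMul Φ n v) :=
  DFinsupp.mapRange_single (hf := fun n => map_zero (charMul Φ n))

theorem charMulSum_single_xBasis (Φ : QSymEnd K) {n : ℕ} (β : Composition n) :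
    charMulSum Φ (DFinsupp.single n (xBasis K n β)) =
      ∑ α : Composition n, transition Φ α.blocks β.blocks • xOfList K α.blocks := by
  rw [charMulSum_single, charMul_xBasis, ← DFinsupp.lsingle_apply (R := K), map_sum]
  refine Finset.sum_congr rfl fun α _ => ?_
  rw [map_smul, xOfList_blocks]
  rfl

/-- Left multiplication by `X^Φ` is an endomorphism for `⋆`. -/
theorem charMulSum_starMul (Φ : QSymEnd K) (v w : DescentSum K) :
    charMulSum Φ (starMul K v w) = starMul K (charMulSum Φ v) (charMulSum Φ w) := by
  have key : (starMul K).compr₂ (charMulSum Φ) =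
      (starMul K).compl₁₂ (charMulSum Φ) (charMulSum Φ) := by
    refine (DFinsupp.basis (xBasis K)).ext fun c => (DFinsupp.basis (xBasis K)).ext fun c' => ?_
    obtain ⟨m, β⟩ := c
    obtain ⟨n, γ⟩ := c'
    rw [basis_descentSum, basis_descentSum, LinearMap.compr₂_apply, LinearMap.compl₁₂_apply,
      starMul_single]
    simp only [charMulSum_single_xBasis, map_sum, map_smul, LinearMap.sum_apply,
      LinearMap.smul_apply]
    have h := sum_cut_eq_sum_append (V := DescentSum K) m n
      (fun l₁ l₂ => (transition Φ l₁ β.blocks * transition Φ l₂ γ.blocks) • xOfList K (l₁ ++ l₂))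
      (by
        intro l₁ l₂ hne
        rw [transition_eq_zero Φ (by rwa [β.blocks_sum]), zero_mul]
        exact zero_smul K (xOfList K (l₁ ++ l₂)))
    simp only [List.take_append_drop, ← Finset.sum_smul] at h
    have hb : (β.append γ).blocks = β.blocks ++ γ.blocks := rfl
    simp only [hb, transition_append]
    rw [h, Finset.sum_comm]
    refine Finset.sum_congr rfl fun α₂ _ => ?_
    rw [Finset.smul_sum]
    refine Finset.sum_congr rfl fun α₁ _ => ?_
    rw [mul_comm, starMul_xOfList (fun a ha => α₁.blocks_pos ha) (fun a ha => α₂.blocks_pos ha), smul_smul]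
  exact congrArg (fun f : DescentSum K →ₗ[K] DescentSum K →ₗ[K] DescentSum K => f v w) key

variable (K) in
/-- The span of the `X_α` for which `α` has at least `k` parts. -/
def lengthGE (k : ℕ) : Submodule K (DescentSum K) :=
  Submodule.span K {w | ∃ l : List ℕ, (∀ a ∈ l, 0 < a) ∧ k ≤ l.length ∧ w = xOfList K l}

theorem xOfList_mem_lengthGE {l : List ℕ} (h : ∀ a ∈ l, 0 < a) {k : ℕ} (hk : k ≤ l.length) :
    xOfList K l ∈ lengthGE K k :=
  Submodule.subset_span ⟨l, h, hk, rfl⟩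

theorem lengthGE_anti {j k : ℕ} (h : j ≤ k) : lengthGE K k ≤ lengthGE K j :=
  Submodule.span_mono fun _ ⟨l, hl, hk, e⟩ => ⟨l, hl, h.trans hk, e⟩

theorem starMul_mem_lengthGE {i j : ℕ} {v w : DescentSum K} (hv : v ∈ lengthGE K i)
    (hw : w ∈ lengthGE K j) : starMul K v w ∈ lengthGE K (i + j) := by
  induction hv using Submodule.span_induction with
  | mem x hx =>
    obtain ⟨l, hl, hi, rfl⟩ := hx
    induction hw using Submodule.span_induction with
    | mem y hy =>
      obtain ⟨l', hl', hj, rfl⟩ := hy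
      rw [starMul_xOfList hl hl']
      refine xOfList_mem_lengthGE (fun a ha => ?_) (by rw [List.length_append]; omega)
      exact (List.mem_append.mp ha).elim (hl a) (hl' a)
    | zero => rw [map_zero]; exact zero_mem _
    | add x y _ _ hx hy => rw [map_add]; exact add_mem hx hy
    | smul a x _ hx => rw [map_smul]; exact Submodule.smul_mem _ _ hx
  | zero => rw [map_zero]; exact zero_mem _
  | add x y _ _ hx hy => rw [map_add]; exact add_mem hx hy
  | smul a x _ hx => rw [map_smul]; exact Submodule.smul_mem _ _ hx

theorem repr_eq_zero_of_mem_lengthGE {k : ℕ} {w : DescentSum K} (hw : w ∈ lengthGE K k) {n : ℕ}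
    {γ : Composition n} (hγ : γ.length < k) : (xBasis K n).repr (w n) γ = 0 := by
  classical
  induction hw using Submodule.span_induction with
  | mem x hx =>
    obtain ⟨l, hl, hi, rfl⟩ := hx
    rw [xOfList, dif_pos hl]
    by_cases h : l.sum = n
    · subst h
      rw [DFinsupp.single_eq_same, Module.Basis.repr_self, Finsupp.single_eq_of_ne]
      rintro rfl
      exact absurd hγ (not_lt.mpr hi)
    · rw [DFinsupp.single_eq_of_ne (Ne.symm h), map_zero, Finsupp.zero_apply]
  | zero => simp
  | add x y _ _ hx hy => rw [DFinsupp.add_apply, map_add, Finsupp.add_apply, hx, hy, add_zero]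
  | smul a x _ hx => rw [DFinsupp.smul_apply, map_smul, Finsupp.smul_apply, hx, smul_zero]

/-! ### The eigenvectors `Z_α` -/

theorem partialSums_subset_of_transition_ne_zero (Φ : QSymEnd K) (l' : List ℕ) {n : ℕ}
    (α : Composition n) (h : transition Φ α.blocks l' ≠ 0) :
    partialSums l' ⊆ partialSums α.blocks := by
  induction l' generalizing n with
  | nil =>
    rintro i ⟨j, rfl⟩
    simpa using zero_mem_partialSums α.blocks
  | cons b l' ih =>
    rw [← List.singleton_append, transition_append] at h
    obtain ⟨j, -, hj⟩ := Finset.exists_ne_zero_of_sum_ne_zero h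
    have h1 : (α.blocks.take j).sum = b := by
      by_contra hne
      exact left_ne_zero_of_mul hj (transition_eq_zero Φ (by simpa using hne))
    have h2 := ih (dropParts α j) (right_ne_zero_of_mul hj)
    intro i hi
    rw [← List.take_append_drop j α.blocks, mem_partialSums_append, h1]
    rcases mem_partialSums_cons.mp hi with rfl | ⟨k, hk, rfl⟩
    · exact Or.inl (zero_mem_partialSums _)
    · exact Or.inr ⟨k, h2 hk, rfl⟩

/-- `Φ` is triangular for the refinement order. -/
theorem cuts_subset_of_transition_ne_zero (Φ : QSymEnd K) {n : ℕ} {α β : Composition n}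
    (h : transition Φ α.blocks β.blocks ≠ 0) : cuts β ⊆ cuts α := by
  intro i hi
  rw [mem_cuts_iff_partialSums] at hi ⊢
  exact ⟨hi.1, hi.2.1, partialSums_subset_of_transition_ne_zero Φ _ α h hi.2.2⟩

/-- The diagonal entries of the matrix of `Φ` are the `λ_α`. -/
theorem transition_self (Φ : QSymEnd K) (l : List ℕ) (hl : ∀ a ∈ l, 0 < a) :
    transition Φ l l = (l.map (lam Φ)).prod := by
  induction l with
  | nil => rw [transition_nil, List.map_nil, List.prod_nil]
  | cons a l ih =>
    have hl' : ∀ b ∈ l, 0 < b := fun b hb => hl b (List.mem_cons_of_mem _ hb)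
    have ha : 0 < a := hl a List.mem_cons_self
    have h := transition_append Φ (⟨a :: l, fun h => hl _ h, rfl⟩ : Composition (a :: l).sum) [a] l
    change transition Φ (a :: l) (a :: l) = ∑ j ∈ Finset.range ((a :: l).length + 1),
      transition Φ ((a :: l).take j) [a] * transition Φ ((a :: l).drop j) l at h
    rw [h, Finset.sum_eq_single 1]
    · rw [List.map_cons, List.prod_cons, lam_eq_transition, onePart_blocks ha, ← ih hl']
      rfl
    -- The first `j` parts of `a :: l` have sum `a` only for `j = 1`.
    · intro j hj hne
      rw [transition_eq_zero, zero_mul]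
      rcases j with _ | _ | j
      · simp
        omega
      · exact absurd rfl hne
      · rcases l with _ | ⟨b, l⟩
        · simp at hj
        · have := hl' b List.mem_cons_self
          simp
          omega
    · intro h
      simp at h

theorem cuts_onePart (m : ℕ) : cuts (onePart m) = ∅ := by
  cases m with
  | zero => rfl
  | succ m =>
    rw [cuts, Finset.image_eq_empty]
    rfl

theorem zCoeff_onePart (Φ : QSymEnd K) (m : ℕ) : zCoeff Φ m (onePart m) = 1 := by
  rw [zCoeff, if_pos rfl]

theorem pairingM_mul_xSum (Φ : QSymEnd K) {n : ℕ} (α β : Composition n) :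
    pairingM ((charSeries Φ n : MonoidAlgebra K (Equiv.Perm (Fin n))) * xSum K α) β =
      transition Φ β.blocks α.blocks := by
  have hmem : (charSeries Φ n : MonoidAlgebra K (Equiv.Perm (Fin n))) * xSum K α ∈
      descentAlgebra K n := charSeries_mul_mem Φ n _ (Submodule.subset_span ⟨α, rfl⟩)
  have h : (⟨_, hmem⟩ : descentAlgebra K n) = charMul Φ n (xBasis K n α) := by
    apply Subtype.ext
    change _ = (charSeries Φ n).1 * (xBasis K n α).1
    rw [coe_xBasis]
  rw [pairingM, dif_pos hmem, h, charMul_xBasis]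
  simp [Finsupp.single_apply]

theorem repr_zElem (Φ : QSymEnd K) {m : ℕ} (β : Composition m) :
    (xBasis K m).repr (zElem Φ m) β = zCoeff Φ m β := by
  simp [zElem, Finsupp.single_apply]

theorem repr_charMul (Φ : QSymEnd K) {n : ℕ} (v : descentAlgebra K n) (β : Composition n) :
    (xBasis K n).repr (charMul Φ n v) β =
      ∑ α, (xBasis K n).repr v α * transition Φ β.blocks α.blocks := by
  conv_lhs => rw [← (xBasis K n).sum_repr v]
  simp only [map_sum, map_smul, charMul_xBasis, Finsupp.finsetSum_apply, Finsupp.smul_apply,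
    smul_eq_mul, Module.Basis.repr_self]
  refine Finset.sum_congr rfl fun α _ => ?_
  congr 1
  simp [Finsupp.single_apply]

/-- The recursion for `Z_m` is the coordinate form of the eigenvector equation. -/
theorem charMul_zElem (Φ : QSymEnd K) (m : ℕ)
    (h : ∀ β : Composition m, β ≠ onePart m → lam Φ m ≠ lamComp Φ β) :
    charMul Φ m (zElem Φ m) = lam Φ m • zElem Φ m := by
  classical
  refine (xBasis K m).repr.injective (Finsupp.ext fun β => ?_)
  rw [repr_charMul, map_smul, Finsupp.smul_apply, repr_zElem, smul_eq_mul]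
  simp only [repr_zElem]
  by_cases hβ : β = onePart m
  · subst hβ
    rw [Finset.sum_eq_single (onePart m), ← lam_eq_transition, mul_comm]
    · intro α _ hα
      by_contra hne
      refine hα (cuts_injective m ?_)
      rw [cuts_onePart, ← Finset.subset_empty, ← cuts_onePart m]
      exact cuts_subset_of_transition_ne_zero Φ (right_ne_zero_of_mul hne)
    · intro hn
      exact absurd (Finset.mem_univ _) hn
  · have hrec : (lam Φ m - lamComp Φ β) * zCoeff Φ m β =
        ∑ α : {α : Composition m // cuts α ⊂ cuts β},
          zCoeff Φ m α.1 * transition Φ β.blocks α.1.blocks := by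
      rw [zCoeff, if_neg hβ, mul_inv_cancel_left₀ (sub_ne_zero.mpr (h β hβ))]
      simp only [pairingM_mul_xSum]
    have hsplit : ∑ α, zCoeff Φ m α * transition Φ β.blocks α.blocks =
        zCoeff Φ m β * lamComp Φ β + ∑ α : {α : Composition m // cuts α ⊂ cuts β},
          zCoeff Φ m α.1 * transition Φ β.blocks α.1.blocks := by
      rw [← Finset.add_sum_erase _ _ (Finset.mem_univ β),
        transition_self Φ β.blocks fun a ha => β.blocks_pos ha, lamComp]
      congr 1
      rw [← Finset.sum_subtype (Finset.univ.filter fun α : Composition m => cuts α ⊂ cuts β)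
        (by simp) fun α => zCoeff Φ m α * transition Φ β.blocks α.blocks]
      symm
      refine Finset.sum_subset ?_ ?_
      · intro α hα
        rw [Finset.mem_filter] at hα
        rw [Finset.mem_erase]
        refine ⟨?_, Finset.mem_univ _⟩
        rintro rfl
        exact hα.2.ne rfl
      · intro α hα hn
        by_contra hne
        rw [Finset.mem_erase] at hα
        refine hn (Finset.mem_filter.mpr ⟨Finset.mem_univ _, ?_⟩)
        exact (cuts_subset_of_transition_ne_zero Φ (right_ne_zero_of_mul hne)).ssubset_of_ne
          fun e => hα.1 (cuts_injective m e)
    rw [hsplit, ← hrec]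
    ring

/-- `Z_{a₁} ⋆ ⋯ ⋆ Z_{a_k}` as an element of `𝒟`, for `l = [a₁, …, a_k]`. -/
def zSum (Φ : QSymEnd K) (l : List ℕ) : DescentSum K :=
  (l.map fun a => DFinsupp.single a (zElem Φ a)).foldr (fun u v => starMul K u v)
    (DFinsupp.single 0 (xBasis K 0 (onePart 0)))

theorem zSum_nil (Φ : QSymEnd K) : zSum Φ [] = xOfList K [] :=
  (xOfList_blocks (onePart 0)).symm

theorem zSum_cons (Φ : QSymEnd K) (a : ℕ) (l : List ℕ) :
    zSum Φ (a :: l) = starMul K (DFinsupp.single a (zElem Φ a)) (zSum Φ l) := rfl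

theorem charMulSum_zSum (Φ : QSymEnd K) (l : List ℕ) (h : ∀ a ∈ l, lam Φ a ≠ 0 ∧
      ∀ β : Composition a, β ≠ onePart a → lam Φ a ≠ lamComp Φ β) :
    charMulSum Φ (zSum Φ l) = (l.map (lam Φ)).prod • zSum Φ l := by
  induction l with
  | nil =>
    rw [zSum, List.map_nil, List.foldr_nil, List.map_nil, List.prod_nil, one_smul,
      charMulSum_single]
    have : Subsingleton (Composition 0) :=
      Fintype.card_le_one_iff_subsingleton.mp (by simp [composition_card])
    congr 1
    refine (xBasis K 0).repr.injective (Finsupp.ext fun β => ?_)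
    obtain rfl : β = onePart 0 := Subsingleton.elim _ _
    rw [repr_charMul]
    simp only [Module.Basis.repr_self]
    rw [Fintype.sum_subsingleton _ (onePart 0), Finsupp.single_eq_same, one_mul]
    exact transition_nil Φ
  | cons a l ih =>
    rw [zSum_cons, charMulSum_starMul, charMulSum_single,
      charMul_zElem Φ a (h a List.mem_cons_self).2,
      ih fun b hb => h b (List.mem_cons_of_mem _ hb), map_smul, DFinsupp.single_smul, map_smul,
      LinearMap.smul_apply, smul_smul, List.map_cons, List.prod_cons, mul_comm]

theorem length_of_ne_onePart {m : ℕ} {β : Composition m} (h : β ≠ onePart m) : 2 ≤ β.length := by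
  by_contra hlt
  refine h (cuts_injective m ?_)
  rw [cuts_onePart, cuts, Finset.image_eq_empty]
  ext i
  simp
  omega

theorem single_zElem_eq_add (Φ : QSymEnd K) {a : ℕ} (ha : 0 < a) :
    ∃ r ∈ lengthGE K 2, DFinsupp.single a (zElem Φ a) = xOfList K [a] + r := by
  classical
  refine ⟨∑ β ∈ Finset.univ.erase (onePart a), zCoeff Φ a β • xOfList K β.blocks, ?_, ?_⟩
  · exact Submodule.sum_mem _ fun β hβ => Submodule.smul_mem _ _ (xOfList_mem_lengthGE
      (fun b hb => β.blocks_pos hb) (length_of_ne_onePart (Finset.ne_of_mem_erase hβ)))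
  · rw [← onePart_blocks ha, zElem, ← Finset.add_sum_erase _ _ (Finset.mem_univ (onePart a)),
      zCoeff_onePart, one_smul, DFinsupp.single_add, xOfList_blocks]
    congr 1
    refine (map_sum (DFinsupp.lsingle (R := K) (M := fun n => descentAlgebra K n) a) _ _).trans
      (Finset.sum_congr rfl fun β _ => ?_)
    rw [map_smul, xOfList_blocks]
    rfl

/-- `Z_α` is `X_α` up to terms with more parts. -/
theorem zSum_eq_add (Φ : QSymEnd K) (l : List ℕ) (hl : ∀ a ∈ l, 0 < a) :
    ∃ r ∈ lengthGE K (l.length + 1), zSum Φ l = xOfList K l + r := by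
  induction l with
  | nil => exact ⟨0, zero_mem _, by rw [zSum_nil, add_zero]⟩
  | cons a l ih =>
    have ha := hl a List.mem_cons_self
    have hl' : ∀ b ∈ l, 0 < b := fun b hb => hl b (List.mem_cons_of_mem _ hb)
    obtain ⟨r, hr, h1⟩ := single_zElem_eq_add Φ ha
    obtain ⟨r', hr', h2⟩ := ih hl'
    have hx : xOfList K [a] ∈ lengthGE K 1 :=
      xOfList_mem_lengthGE (by simpa using ha) le_rfl
    have hz : xOfList K l + r' ∈ lengthGE K l.length :=
      add_mem (xOfList_mem_lengthGE hl' le_rfl) (lengthGE_anti (Nat.le_succ _) hr')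
    refine ⟨starMul K (xOfList K [a]) r' + starMul K r (xOfList K l + r'), add_mem ?_ ?_, ?_⟩
    · exact lengthGE_anti (by rw [List.length_cons]; omega) (starMul_mem_lengthGE hx hr')
    · exact lengthGE_anti (by rw [List.length_cons]; omega) (starMul_mem_lengthGE hr hz)
    · have hx' := starMul_xOfList (K := K) (l := [a]) (by simpa using ha) hl'
      rw [List.singleton_append] at hx'
      rw [zSum_cons, h1, h2, ← hx', (starMul K).map_add, LinearMap.add_apply,
        (starMul K (xOfList K [a])).map_add, add_assoc]

open Classical in
theorem repr_zComp (Φ : QSymEnd K) {n : ℕ} (α γ : Composition n) (h : γ.length ≤ α.length) :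
    (xBasis K n).repr (zComp Φ α) γ = if α = γ then 1 else 0 := by
  obtain ⟨r, hr, h1⟩ := zSum_eq_add Φ α.blocks fun a ha => α.blocks_pos ha
  change (xBasis K n).repr (zSum Φ α.blocks n) γ = _
  rw [h1, DFinsupp.add_apply, map_add, Finsupp.add_apply,
    repr_eq_zero_of_mem_lengthGE hr (Nat.lt_succ_of_le h), add_zero,
    xOfList_blocks, DFinsupp.single_eq_same, Module.Basis.repr_self, Finsupp.single_apply]

/-- Independence holds for all `α`, including those for which some denominator in the recursion
vanishes: the leading term `X_α` of `Z_α` does not depend on the coefficients the recursion gives. -/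
theorem linearIndependent_zComp (Φ : QSymEnd K) (n : ℕ) :
    LinearIndependent K (fun α : Composition n => zComp Φ α) := by
  classical
  rw [Fintype.linearIndependent_iff]
  intro g hg
  have main : ∀ k, ∀ α : Composition n, α.length = k → g α = 0 := by
    intro k
    induction k using Nat.strong_induction_on with
    | _ k ih =>
      intro α hα
      have h := congrArg (fun w => (xBasis K n).repr w α) hg
      simp only [map_sum, map_smul, Finsupp.finsetSum_apply, Finsupp.smul_apply, map_zero,
        Finsupp.zero_apply, smul_eq_mul] at h
      rw [Finset.sum_eq_single_of_mem α (Finset.mem_univ _), repr_zComp Φ α α le_rfl,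
        if_pos rfl, mul_one] at h
      · exact h
      · intro β _ hβ
        rcases lt_or_ge β.length α.length with hlt | hge
        · rw [ih _ (hα ▸ hlt) β rfl, zero_mul]
        · rw [repr_zComp Φ β α hge, if_neg hβ, mul_zero]
  exact fun α => main _ α rfl

theorem charMul_zComp (Φ : QSymEnd K) (n : ℕ)
    (hsep : ∀ m ≤ n, lam Φ m ≠ 0 →
      ∀ β : Composition m, β ≠ onePart m → lam Φ m ≠ lamComp Φ β)
    (α : Composition n) (hα : lamComp Φ α ≠ 0) :
    charMul Φ n (zComp Φ α) = lamComp Φ α • zComp Φ α := by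
  have h := charMulSum_zSum Φ α.blocks fun a ha => by
    have h0 : lam Φ a ≠ 0 := fun h0 =>
      hα (List.prod_eq_zero (List.mem_map.mpr ⟨a, ha, h0⟩))
    refine ⟨h0, hsep a ?_ h0⟩
    rw [← α.blocks_sum]
    exact List.le_sum_of_mem ha
  have h' := congrArg (fun w : DescentSum K => w n) h
  rw [DFinsupp.smul_apply] at h'
  exact h'

end QSymWalk
end

theorem theorem4p3 {K : Type*} [Field K] [CharZero K] (Φ : QSymEnd K) (n : ℕ)
    (hsep : ∀ m ≤ n, lam Φ m ≠ 0 →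
      ∀ β : Composition m, β ≠ onePart m → lam Φ m ≠ lamComp Φ β)
    (hrank : Module.finrank K (LinearMap.range (Φ.degreeMap n)) =
      Nat.card {α : Composition n // lamComp Φ α ≠ 0}) :
    IsDiagonalizable (V := degreePart K n) (Φ.degreeMap n) ∧
    ∃ hmul : ∀ v ∈ descentAlgebra K n,
        (charSeries Φ n : MonoidAlgebra K (Equiv.Perm (Fin n))) * v ∈ descentAlgebra K n,
      IsDiagonalizable (leftMul (charSeries Φ n).1 hmul) ∧
      (∀ α : Composition n, lamComp Φ α ≠ 0 →
        leftMul (charSeries Φ n).1 hmul (zComp Φ α) = lamComp Φ α • zComp Φ α) ∧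
      LinearIndependent K
        (fun α : {α : Composition n // lamComp Φ α ≠ 0} => zComp Φ α.1) ∧
      ∀ μ : K, μ ≠ 0 → Module.End.eigenspace (leftMul (charSeries Φ n).1 hmul) μ =
        Submodule.span K {z | ∃ α : Composition n, lamComp Φ α = μ ∧ z = zComp Φ α} := by
  have := Module.Basis.finiteDimensional_of_finite (xBasis K n)
  have hT : ∀ α : Composition n, lamComp Φ α ≠ 0 →
      charMul Φ n (zComp Φ α) = lamComp Φ α • zComp Φ α := charMul_zComp Φ n hsep
  have hli : LinearIndependent K
      (fun α : {α : Composition n // lamComp Φ α ≠ 0} => zComp Φ α.1) :=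
    (linearIndependent_zComp Φ n).comp _ Subtype.val_injective
  classical
  obtain ⟨hdiag, heig⟩ := isDiagonalizable_of_finrank_range (charMul Φ n)
    (fun α : {α : Composition n // lamComp Φ α ≠ 0} => zComp Φ α.1) (fun α => lamComp Φ α.1)
    hli (fun α => α.2) (fun α => hT α.1 α.2)
    (by rw [finrank_range_charMul, hrank, Nat.card_eq_fintype_card])
  refine ⟨hdiag.of_dualMap _ (degreePartEquivDual K n) (degreePartEquivDual_degreeMap Φ n),
    charSeries_mul_mem Φ n, hdiag, hT, hli, fun μ hμ => le_antisymm ?_ ?_⟩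
  · refine (heig μ hμ).trans (Submodule.span_mono ?_)
    rintro _ ⟨α, hα, rfl⟩
    exact ⟨α.1, hα, rfl⟩
  · rw [Submodule.span_le]
    rintro _ ⟨α, hα, rfl⟩
    rw [SetLike.mem_coe, Module.End.mem_eigenspace_iff, ← hα]
    exact hT α (hα ▸ hμ)
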